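/- Let $X=(X_t)_{t\ge 0}$ be an irreducible continuous-time Markov chain on a finite state space $\mathcal X$, with matrix of transition rates $Q$ (semigroup $e^{tQ}$) and invariant probability measure $\pi$, and let $X^{\leftarrow}$ be its time reversal, the Markov chain with rates $Q^*(x,y)=\frac{\pi(y)}{\pi(x)}Q(y,x)$. A superscript $x$ or $\nu$ denotes the starting point or the initial distribution, and $\tau_K=\inf\{t\ge 0: X_t\in K\}$ is the hitting time of $K\subset\mathcal X$ (and $\tau^{\leftarrow}_K$ that of the reversed chain). Let $G\subset\mathcal X$ be such that $G$ and $A:=\mathcal X\setminus G$ are non-empty, and let $\pi_A=\pi(\cdot\cap A)/\pi(A)$. Let $d_{TV}(\mu,\nu)=\frac12\sum_y|\mu(y)-\nu(y)|$. Let $R>1$, $\alpha,d,f,r\in(0,1)$, and put $$B_\alpha=\Big\{x\in A:\ \tfrac12\big[\mathbf P(\tau^x_G\le 2R)+\mathbf P(\tau^{\leftarrow x}_G\le 2R)\big]\le f^\alpha\Big\}.$$ Hypothesis $Hp.G(R,d,f,r)$ means that the following three conditions hold: * slow escape: $\mathbf P(\tau_G^{\pi_A}\le 2R)\le f$; * fast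 thermalization: $d_{TV}\big(\mathbf P(X^x_R=\cdot),\mathbf P(X^{x'}_R=\cdot)\big)\le d$ for all $x,x'\in B_\alpha$; * fast recurrence: $\sup_{x\in\mathcal X}\mathbf P(\tau^x_{B_\alpha\cup G}>R)<r$. Assume $r+2f^\alpha<\frac14$ and let $$\bar c=\tfrac12-\sqrt{\tfrac14-(r+2f^\alpha)},\qquad \varepsilon_2=4\big[\bar c+2f+f^\alpha+d\big]+f^{1-\alpha}.$$ Theorem. There are universal constants $C,\eta>0$ (independent of the chain, of $G$ and of $\alpha,R,d,f,r$) such that whenever $Hp.G(R,d,f,r)$ holds, $r+2f^\alpha<\frac14$ and $r+\varepsilon_2\le\eta$, the following is true. The quasi-stationary measure $\mu^*_A=\lim_{t\to\infty}\mathbf P(X^{\pi_A}_t=\cdot\mid\tau_G^{\pi_A}>t)$ exists (and, if any two points of $A$ communicate through jumps inside $A$, it is also the limit of $\sum_{x\in A}\pi_A(x)\,\mathbf P(X^x_t=\cdot\mid\tau^x_G>t)$), the mean exit time $T^*:=\mathbf E[\tau_G^{\mu^*_A}]$ satisfies $0<T^*<\infty$, and there is $0\le\varepsilon\le C(r+\varepsilon_2)$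 such that: 1. for every $t\ge 0$, $\ \big|\mathbf P(\tau_G^{\pi_A}/T^*\ge t)-e^{-t}\big|\le\varepsilon e^{-t}$; 2. for every $t\ge 0$, $\ \sup_{x\in B_\alpha}\big|\mathbf P(\tau_G^{x}/T^*\ge t)-e^{-t}\big|\le\varepsilon e^{-t}$; 3. for every $x\notin B_\alpha$, with $p_x:=\mathbf P(\tau_G^x>2R,\ \tau^x_{G\cup B_\alpha}\le R)$: for every $t\ge R/T^*$, $\ \big|\mathbf P(\tau_G^{x}/T^*\ge t)-p_x e^{-t}\big|\le\varepsilon e^{-t}$; moreover the lower bound $\mathbf P(\tau_G^{x}/T^*\ge t)\ge (p_x-\varepsilon)e^{-t}$ holds for every $t\ge 0$. -/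

import Mathlib

open MeasureTheory Filter Topology
open scoped NNReal ENNReal

noncomputable section

namespace HittingTime

variable {𝒳 Ω Ω' : Type*} [Fintype 𝒳] [DecidableEq 𝒳] [MeasurableSpace Ω] [MeasurableSpace Ω']

/-- A matrix of transition rates: non-negative off the diagonal, with zero row sums. -/
structure IsRateMatrix (Q : Matrix 𝒳 𝒳 ℝ) : Prop where
  nonneg : ∀ x y, x ≠ y → 0 ≤ Q x y
  row_sum : ∀ x, ∑ y, Q x y = 0

/-- Irreducibility: any state can be reached from any other along positive rates.
(Diagonal rates are non-positive, so every step is a genuine jump.) -/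
def IsIrreducibleRate (Q : Matrix 𝒳 𝒳 ℝ) : Prop :=
  ∀ x y, Relation.ReflTransGen (fun a b => 0 < Q a b) x y

/-- `π` is an invariant probability measure for the rates `Q`. -/
structure IsInvariant (Q : Matrix 𝒳 𝒳 ℝ) (π : 𝒳 → ℝ) : Prop where
  nonneg : ∀ x, 0 ≤ π x
  sum_one : ∑ x, π x = 1
  invariant : ∀ y, ∑ x, π x * Q x y = 0

/-- Rates of the time-reversed chain. -/
def reversedRates (Q : Matrix 𝒳 𝒳 ℝ) (π : 𝒳 → ℝ) : Matrix 𝒳 𝒳 ℝ :=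
  Matrix.of fun x y => π y / π x * Q y x

/-- The transition semigroup `e^{tQ}`. -/
def semigroup (Q : Matrix 𝒳 𝒳 ℝ) (t : ℝ≥0) : Matrix 𝒳 𝒳 ℝ :=
  NormedSpace.exp ((t : ℝ) • Q)

/-- The information `σ(X_u : u ≤ s)` generated by the process up to time `s`. -/
@[reducible] def past (X : ℝ≥0 → Ω → 𝒳) (s : ℝ≥0) : MeasurableSpace Ω :=
  ⨆ u : Set.Iic s, MeasurableSpace.comap (X u) ⊤

/-- `X` under the laws `(P x)` is the continuous time Markov chain with rates `Q`: under `P x` it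
starts at `x`, it has right-continuous paths, and its transitions given the past are `e^{hQ}`. -/
structure IsMarkovChain (Q : Matrix 𝒳 𝒳 ℝ) (P : 𝒳 → Measure Ω) (X : ℝ≥0 → Ω → 𝒳) : Prop where
  prob : ∀ x, IsProbabilityMeasure (P x)
  meas : ∀ t y, MeasurableSet {ω | X t ω = y}
  rightCont : ∀ ω t, ∀ᶠ s in 𝓝[≥] t, X s ω = X t ω
  start : ∀ x, (P x).real {ω | X 0 ω = x} = 1
  markov : ∀ (x : 𝒳) (s h : ℝ≥0) (y z : 𝒳) (E : Set Ω), MeasurableSet[past X s] E →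
    (P x).real (E ∩ {ω | X s ω = y ∧ X (s + h) ω = z}) =
      (P x).real (E ∩ {ω | X s ω = y}) * semigroup Q h y z

/-- First hitting time of `K`, with value `∞` if `K` is never hit. -/
def hit (X : ℝ≥0 → Ω → 𝒳) (K : Set 𝒳) (ω : Ω) : ℝ≥0∞ :=
  ⨅ (t : ℝ≥0) (_ : X t ω ∈ K), (t : ℝ≥0∞)

/-- The law of the chain with initial distribution `ν`. -/
def fromLaw (P : 𝒳 → Measure Ω) (ν : 𝒳 → ℝ) : Measure Ω :=
  ∑ x, ENNReal.ofReal (ν x) • P x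

/-- `π` conditioned on `A`. -/
def restricted (π : 𝒳 → ℝ) (A : Set 𝒳) (y : 𝒳) : ℝ :=
  A.indicator π y / ∑ z, A.indicator π z

/-- Total variation distance. -/
def dTV (μ ν : 𝒳 → ℝ) : ℝ := (1 / 2) * ∑ y, |μ y - ν y|

/-- The law of `X_t` started from `x`. -/
def evol (P : 𝒳 → Measure Ω) (X : ℝ≥0 → Ω → 𝒳) (x : 𝒳) (t : ℝ≥0) (y : 𝒳) : ℝ :=
  (P x).real {ω | X t ω = y}

/-- `m(X_t = y | τ_G > t)`, where `m` is the law of the chain with some initial distribution. -/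
def condEvol (m : Measure Ω) (X : ℝ≥0 → Ω → 𝒳) (G : Set 𝒳) (t : ℝ≥0) (y : 𝒳) : ℝ :=
  m.real {ω | X t ω = y ∧ (t : ℝ≥0∞) < hit X G ω} / m.real {ω | (t : ℝ≥0∞) < hit X G ω}

/-- The quasi-stationary measure on `A = Gᶜ` is `μ`: it is the limit, as `t → ∞`, of the law at
time `t` of the chain started from `π_A` and conditioned not to have left `A`. -/
def IsQuasiStationary (P : 𝒳 → Measure Ω) (X : ℝ≥0 → Ω → 𝒳) (π : 𝒳 → ℝ) (G : Set 𝒳)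
    (μ : 𝒳 → ℝ) : Prop :=
  Tendsto (fun t : ℝ≥0 => condEvol (fromLaw P (restricted π Gᶜ)) X G t) atTop (𝓝 μ)

/-- `μ` is the limit of the `π_A`-average of the conditioned laws of the chain started at points. -/
def IsAveragedLimit (P : 𝒳 → Measure Ω) (X : ℝ≥0 → Ω → 𝒳) (π : 𝒳 → ℝ) (G : Set 𝒳)
    (μ : 𝒳 → ℝ) : Prop :=
  Tendsto (fun (t : ℝ≥0) (y : 𝒳) => ∑ x, restricted π Gᶜ x * condEvol (P x) X G t y)
    atTop (𝓝 μ)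

/-- Any two points of `A` communicate through jumps inside `A`. -/
def IsIrreducibleOn (Q : Matrix 𝒳 𝒳 ℝ) (A : Set 𝒳) : Prop :=
  ∀ x ∈ A, ∀ y ∈ A, Relation.ReflTransGen (fun a b => 0 < Q a b ∧ b ∈ A) x y

/-- The basin `B_α`; `(P, X)` is the chain and `(P', X')` the time-reversed chain. -/
def basin (P : 𝒳 → Measure Ω) (X : ℝ≥0 → Ω → 𝒳) (P' : 𝒳 → Measure Ω') (X' : ℝ≥0 → Ω' → 𝒳)
    (G : Set 𝒳) (R : ℝ≥0) (f α : ℝ) : Set 𝒳 :=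
  {x | x ∈ Gᶜ ∧
    (1 / 2) * ((P x).real {ω | hit X G ω ≤ ((2 * R : ℝ≥0) : ℝ≥0∞)} +
      (P' x).real {ω | hit X' G ω ≤ ((2 * R : ℝ≥0) : ℝ≥0∞)}) ≤ f ^ α}

/-- Slow escape `E(R, f)`. -/
def SlowEscape (P : 𝒳 → Measure Ω) (X : ℝ≥0 → Ω → 𝒳) (π : 𝒳 → ℝ) (G : Set 𝒳) (R : ℝ≥0)
    (f : ℝ) : Prop :=
  (fromLaw P (restricted π Gᶜ)).real {ω | hit X G ω ≤ ((2 * R : ℝ≥0) : ℝ≥0∞)} ≤ f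

/-- Fast thermalization `T(R, d)` in the set `B`. -/
def FastThermalization (P : 𝒳 → Measure Ω) (X : ℝ≥0 → Ω → 𝒳) (B : Set 𝒳) (R : ℝ≥0)
    (d : ℝ) : Prop :=
  ∀ x ∈ B, ∀ x' ∈ B, dTV (evol P X x R) (evol P X x' R) ≤ d

/-- Fast recurrence `Rc(R, r)` to the set `B ∪ G`. -/
def FastRecurrence (P : 𝒳 → Measure Ω) (X : ℝ≥0 → Ω → 𝒳) (B G : Set 𝒳) (R : ℝ≥0)
    (r : ℝ) : Prop :=
  ∀ x, (P x).real {ω | (R : ℝ≥0∞) < hit X (B ∪ G) ω} < r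

/-- Hypothesis `Hp.G(R, d, f, r)`, for the basin `B_α`. -/
structure HpG (P : 𝒳 → Measure Ω) (X : ℝ≥0 → Ω → 𝒳) (P' : 𝒳 → Measure Ω')
    (X' : ℝ≥0 → Ω' → 𝒳) (π : 𝒳 → ℝ) (G : Set 𝒳) (α : ℝ) (R : ℝ≥0) (d f r : ℝ) : Prop where
  R_gt : 1 < R
  d_mem : d ∈ Set.Ioo (0 : ℝ) 1
  f_mem : f ∈ Set.Ioo (0 : ℝ) 1
  r_mem : r ∈ Set.Ioo (0 : ℝ) 1
  slowEscape : SlowEscape P X π G R f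
  recurrence : FastRecurrence P X (basin P X P' X' G R f α) G R r
  thermalization : FastThermalization P X (basin P X P' X' G R f α) R d

/-- `c̄ = 1/2 - √(1/4 - c)` with `c = r + 2 f^α`. -/
def cBar (α f r : ℝ) : ℝ := 1 / 2 - √(1 / 4 - (r + 2 * f ^ α))

/-- `ε₂ = 4 [c̄ + 2 f + f^α + d] + f^{1-α}`. -/
def eps2 (α d f r : ℝ) : ℝ := 4 * (cBar α f r + 2 * f + f ^ α + d) + f ^ (1 - α)

end HittingTime

end

/-! Killing the chain on `G` gives a sub-Markov semigroup whose row sums `mass` are the survival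
probabilities. The analytic half of the proof sees only this semigroup, through the structure
`IsReturnKernel` with a single error κ. Its fields `lower` and `upper` are the Markov property at
the first visit to `B` before time `R`: if the total time is `s + R`, the time left after that visit
lies between `s` and `s + R`, and survival is monotone in time.

The basin is where survival is best: `mass_le_basin` bounds every survival probability by `1 + 10 *
κ` times that from any point of `B`, at all times. This is a bootstrap: a crude factor 2 at two
earlier times already yields the sharp factor, since thermalization makes `B` almost homogeneous and
survival from `B` decays by at most `1 - 2 * κ` per time `R`. With this comparison the kernel
normalized to mass one forgets its start geometrically (`deviation_contracts`), faster than the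
survival probability itself can decay. Hence the conditioned laws converge to a common limit μ,
which is an eigenvector of the semigroup (`exists_quasiStationary`).

Under an eigenvector, survival is multiplicative in time and so exactly exponential
(`exists_exp_rate`); its rate is the inverse of the mean exit time. The other starting laws are
compared with `decay S μ` by errors proportional to `decay S μ` itself, which is why the factor `exp
(-t)` survives in the final bounds (`abs_basin_sub_decay_le`, `abs_average_sub_decay_le`,
`abs_mass_sub_mul_decay_le`).

The probabilistic half, `isReturnKernel_killed`, shows that the killed chain is a return kernel. The
Markov property is given only at deterministic times; right-continuity and dyadic grids extend it to
killing and to first visits. Time reversal preserves the mean survival under the restricted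
invariant law, so Markov's inequality makes the basin carry most of that law. Stationarity and
thermalization then show that a path which visited the basin is seldom outside it later. -/

noncomputable section

/-! ### Return kernels: comparison of survival probabilities and loss of memory. -/

namespace HittingTime

open Matrix

variable {𝒳 : Type*} [Fintype 𝒳]

/-- The total mass `∑ y, S_t(x, y)` of a kernel. -/
def mass (S : ℝ≥0 → Matrix 𝒳 𝒳 ℝ) (t : ℝ≥0) (x : 𝒳) : ℝ := ∑ y, S t x y

/-- The mass `∑_{y ∈ F} S_t(x, y)` given to `F`. -/
def massOn (S : ℝ≥0 → Matrix 𝒳 𝒳 ℝ) (F : Set 𝒳) (t : ℝ≥0) (x : 𝒳) : ℝ :=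
  ∑ y, F.indicator (S t x) y

lemma massOn_univ (S : ℝ≥0 → Matrix 𝒳 𝒳 ℝ) (t : ℝ≥0) (x : 𝒳) :
    massOn S Set.univ t x = mass S t x := by
  simp [massOn, mass]

/-- A sub-Markov semigroup `S` which loses little mass on `B` during a time `2R`, forgets its
starting point in `B` during a time `R`, and returns to `B`: `q x` is the probability to visit `B`
before time `R` and before being killed. All errors are bounded by `κ`. -/
structure IsReturnKernel (S : ℝ≥0 → Matrix 𝒳 𝒳 ℝ) (B : Set 𝒳) (q : 𝒳 → ℝ)
    (R : ℝ≥0) (κ : ℝ) : Prop where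
  κ_nonneg : 0 ≤ κ
  κ_le : κ ≤ 1 / 100
  R_pos : 0 < R
  nonneg : ∀ t x y, 0 ≤ S t x y
  add : ∀ s t, S (s + t) = S s * S t
  mass_le : ∀ t x, mass S t x ≤ 1
  nonempty : B.Nonempty
  q_nonneg : ∀ x, 0 ≤ q x
  q_le : ∀ x, q x ≤ 1
  lower : ∀ s x L, (∀ b ∈ B, L ≤ mass S (s + R) b) → q x * L ≤ mass S (s + R) x
  upper : ∀ s x H U, (∀ y, mass S s y ≤ H) → (∀ b ∈ B, mass S s b ≤ U) →
    mass S (s + R) x ≤ κ * H + q x * U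
  ret : ∀ x, mass S R x - κ ≤ q x
  slow : ∀ b ∈ B, 1 - κ ≤ mass S (2 * R) b
  therm : ∀ x ∈ B, ∀ x' ∈ B, ∑ y, |S R x y - S R x' y| ≤ 2 * κ
  leave : ∀ x, ∑ y, Bᶜ.indicator (S (2 * R) x) y ≤ κ

lemma mulVec_one_eq_mass (S : ℝ≥0 → Matrix 𝒳 𝒳 ℝ) (t : ℝ≥0) : S t *ᵥ 1 = mass S t := by
  ext x; simp [mulVec, dotProduct, mass]

namespace IsReturnKernel

variable {S : ℝ≥0 → Matrix 𝒳 𝒳 ℝ} {B : Set 𝒳} {q : 𝒳 → ℝ} {R : ℝ≥0} {κ : ℝ}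

section

variable (h : IsReturnKernel S B q R κ)
include h

lemma mass_nonneg (t : ℝ≥0) (x : 𝒳) : 0 ≤ mass S t x :=
  Finset.sum_nonneg fun _ _ => h.nonneg _ _ _

lemma mass_add (s t : ℝ≥0) (x : 𝒳) : mass S (s + t) x = ∑ y, S s x y * mass S t y := by
  have : mass S (s + t) = S s *ᵥ mass S t := by
    rw [← mulVec_one_eq_mass, ← mulVec_one_eq_mass, h.add, mulVec_mulVec]
  rw [this]; rfl

lemma mass_add_le (s t : ℝ≥0) (x : 𝒳) : mass S (s + t) x ≤ mass S s x := by
  rw [h.mass_add]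
  exact Finset.sum_le_sum fun y _ =>
    mul_le_of_le_one_right (h.nonneg _ _ _) (h.mass_le _ _)

lemma mass_anti {s t : ℝ≥0} (hst : s ≤ t) (x : 𝒳) : mass S t x ≤ mass S s x := by
  obtain ⟨u, rfl⟩ := exists_add_of_le hst
  exact h.mass_add_le _ _ _

lemma mass_basin_lower {s : ℝ≥0} (hs : s ≤ 2 * R) {b : 𝒳} (hb : b ∈ B) : 1 - κ ≤ mass S s b :=
  (h.slow b hb).trans (h.mass_anti hs b)

/-- The smallest survival probability from `B` decreases slowly. -/
lemma mass_basin_step {s : ℝ≥0} {M : ℝ} (hM : ∀ b ∈ B, M ≤ mass S s b) (hM0 : 0 ≤ M)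
    {b : 𝒳} (hb : b ∈ B) : (1 - 2 * κ) * M ≤ mass S (s + R) b := by
  have hκ := h.κ_nonneg
  have hκ' := h.κ_le
  have hM1 : M ≤ 1 := (hM b hb).trans (h.mass_le _ _)
  rcases le_total s R with hs | hs
  · have h1 := h.mass_basin_lower (s := s + R) (by rw [two_mul]; gcongr) hb
    nlinarith
  · obtain ⟨u, rfl⟩ := exists_add_of_le hs
    -- Survival up to time `R` means a visit to `B`, up to κ. Averaging this over one further
    -- initial period `R` turns the factor into the mass at `2 * R` minus κ, which `slow` controls;
    -- using the mass at `R` alone, for one period, would lose the gain at the next step.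
    have h1 : ∀ y, (mass S R y - κ) * M ≤ mass S (R + u) y := fun y => by
      rw [add_comm R u]
      refine le_trans ?_ (h.lower u y M fun b hb => by rw [add_comm]; exact hM b hb)
      exact mul_le_mul_of_nonneg_right (h.ret y) hM0
    have h2 : ∑ y, S R b y * ((mass S R y - κ) * M) ≤ mass S (R + (R + u)) b := by
      rw [h.mass_add]
      exact Finset.sum_le_sum fun y _ => mul_le_mul_of_nonneg_left (h1 y) (h.nonneg _ _ _)
    have h3 : ∑ y, S R b y * ((mass S R y - κ) * M)
        = (mass S (R + R) b - κ * mass S R b) * M := by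
      rw [h.mass_add, mass, Finset.mul_sum, ← Finset.sum_sub_distrib, Finset.sum_mul]
      exact Finset.sum_congr rfl fun y _ => by ring
    have h4 := h.slow b hb
    rw [two_mul] at h4
    have h5 := h.mass_le R b
    rw [h3] at h2
    rw [add_comm (R + u) R]
    refine le_trans (mul_le_mul_of_nonneg_right ?_ hM0) h2
    nlinarith

lemma mass_basin_iterate {s : ℝ≥0} {M : ℝ} (hM : ∀ b ∈ B, M ≤ mass S s b) (hM0 : 0 ≤ M)
    (n : ℕ) {t : ℝ≥0} (ht : t ≤ n * R) {b : 𝒳} (hb : b ∈ B) :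
    (1 - 2 * κ) ^ n * M ≤ mass S (s + t) b := by
  have hκ' := h.κ_le
  have key : ∀ n : ℕ, ∀ b ∈ B, (1 - 2 * κ) ^ n * M ≤ mass S (s + n * R) b := by
    intro n
    induction n with
    | zero => simpa using hM
    | succ n ih =>
      intro b hb
      have := h.mass_basin_step ih (mul_nonneg (pow_nonneg (by linarith) n) hM0) hb
      rw [pow_succ', mul_assoc]; push_cast; rw [add_mul, one_mul, ← add_assoc]; exact this
  exact (key n b hb).trans (h.mass_anti (by gcongr) b)

lemma exists_nat_mul_ge (t : ℝ≥0) : ∃ n : ℕ, t ≤ n * R := by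
  obtain ⟨n, hn⟩ := exists_nat_ge (t / R)
  exact ⟨n, by rwa [div_le_iff₀ h.R_pos] at hn⟩

lemma mass_basin_pos {b : 𝒳} (hb : b ∈ B) (s : ℝ≥0) : 0 < mass S s b := by
  have hκ := h.κ_nonneg
  have hκ' := h.κ_le
  obtain ⟨n, hn⟩ := h.exists_nat_mul_ge s
  have := h.mass_basin_iterate (s := 0) (fun b hb => h.mass_basin_lower zero_le hb)
    (by linarith) n hn hb
  rw [zero_add] at this
  refine lt_of_lt_of_le (mul_pos (pow_pos ?_ n) ?_) this <;> linarith

/-- Thermalization in dual form: one period `R` makes any bounded function nearly constant on `B`.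
-/
lemma abs_mulVec_sub_le {φ : 𝒳 → ℝ} {H : ℝ} (hφ : ∀ y, |φ y| ≤ H) {x x' : 𝒳} (hx : x ∈ B)
    (hx' : x' ∈ B) : |(S R *ᵥ φ) x - (S R *ᵥ φ) x'| ≤ 2 * κ * H := by
  have hH : 0 ≤ H := (abs_nonneg _).trans (hφ x)
  calc |(S R *ᵥ φ) x - (S R *ᵥ φ) x'| = |∑ y, (S R x y - S R x' y) * φ y| := by
        simp only [mulVec, dotProduct, ← Finset.sum_sub_distrib, sub_mul]
    _ ≤ ∑ y, |S R x y - S R x' y| * H := by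
        refine (Finset.abs_sum_le_sum_abs _ _).trans (Finset.sum_le_sum fun y _ => ?_)
        rw [abs_mul]
        exact mul_le_mul_of_nonneg_left (hφ y) (abs_nonneg _)
    _ ≤ 2 * κ * H := by
        rw [← Finset.sum_mul]
        exact mul_le_mul_of_nonneg_right (h.therm x hx x' hx') hH

/-- The self-improving step. The factor 2 at time `s` makes the masses on `B` at `s + R` agree up to
`4 * κ` times the smallest basin mass at `s`; at `s + R` it is only multiplied by κ, in the term of
`upper` for paths that miss `B`. The basin masses at the three times are then compared through
`mass_basin_step`. -/
lemma mass_le_basin_step {s : ℝ≥0} (h0 : ∀ x, ∀ b ∈ B, mass S s x ≤ 2 * mass S s b)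
    (h1 : ∀ x, ∀ b ∈ B, mass S (s + R) x ≤ 2 * mass S (s + R) b) (x : 𝒳) {b : 𝒳} (hb : b ∈ B) :
    mass S (s + R + R) x ≤ (1 + 10 * κ) * mass S (s + R + R) b := by
  have hκ := h.κ_nonneg
  have hκ' := h.κ_le
  obtain ⟨b₀, hb₀, hmin₀⟩ := Set.exists_min_image B (mass S s) (Set.toFinite B) h.nonempty
  obtain ⟨b₁, hb₁, hmin₁⟩ := Set.exists_min_image B (mass S (s + R)) (Set.toFinite B) h.nonempty
  have e0 := h.mass_basin_step hmin₀ (h.mass_nonneg _ _) hb₁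
  have e1 := h.mass_basin_step hmin₁ (h.mass_nonneg _ _) hb
  have hU : ∀ b' ∈ B, mass S (s + R) b' ≤ mass S (s + R) b₁ + 4 * κ * mass S s b₀ := by
    intro b' hb'
    have := h.abs_mulVec_sub_le (φ := mass S s) (H := 2 * mass S s b₀)
      (fun y => by rw [abs_of_nonneg (h.mass_nonneg _ _)]; exact h0 y b₀ hb₀) hb' hb₁
    have e : S R *ᵥ mass S s = mass S (s + R) := by
      ext y; rw [add_comm, h.mass_add]; rfl
    rw [e] at this
    linarith [(abs_le.mp this).2]
  have hup := h.upper (s + R) x _ _ (fun y => h1 y b₁ hb₁) hU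
  have g0 := h.mass_nonneg s b₀
  have g1 := h.mass_nonneg (s + R) b₁
  have hq := h.q_le x
  have hup' : mass S (s + R + R) x ≤ (1 + 2 * κ) * mass S (s + R) b₁ + 4 * κ * mass S s b₀ := by
    nlinarith [mul_nonneg hκ g0]
  have e2 : mass S s b₀ ≤ (1 + 3 * κ) * mass S (s + R) b₁ := by
    nlinarith [mul_nonneg hκ g0, mul_nonneg hκ g1, mul_nonneg hκ (mul_nonneg hκ g0)]
  have e3 : mass S (s + R) b₁ ≤ (1 + 3 * κ) * mass S (s + R + R) b := by
    have g2 := h.mass_nonneg (s + R + R) b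
    nlinarith [mul_nonneg hκ g1, mul_nonneg hκ g2, mul_nonneg hκ (mul_nonneg hκ g1)]
  have g2 := h.mass_nonneg (s + R + R) b
  have c1 : 1 + 2 * κ + 4 * κ * (1 + 3 * κ) ≤ 1 + 6.2 * κ := by nlinarith
  have c2 : (1 + 6.2 * κ) * (1 + 3 * κ) ≤ 1 + 10 * κ := by nlinarith
  calc mass S (s + R + R) x ≤ (1 + 2 * κ) * mass S (s + R) b₁ + 4 * κ * mass S s b₀ := hup'
    _ ≤ (1 + 2 * κ) * mass S (s + R) b₁ + 4 * κ * ((1 + 3 * κ) * mass S (s + R) b₁) := by gcongr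
    _ = (1 + 2 * κ + 4 * κ * (1 + 3 * κ)) * mass S (s + R) b₁ := by ring
    _ ≤ (1 + 6.2 * κ) * ((1 + 3 * κ) * mass S (s + R + R) b) := by gcongr
    _ = ((1 + 6.2 * κ) * (1 + 3 * κ)) * mass S (s + R + R) b := by ring
    _ ≤ (1 + 10 * κ) * mass S (s + R + R) b := by gcongr

/-- No starting point survives much better than the points of `B`. -/
lemma mass_le_basin (s : ℝ≥0) (x : 𝒳) {b : 𝒳} (hb : b ∈ B) :
    mass S s x ≤ (1 + 10 * κ) * mass S s b := by
  have hκ := h.κ_nonneg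
  have hκ' := h.κ_le
  have key : ∀ n : ℕ, ∀ s : ℝ≥0, s ≤ n * R → ∀ x, ∀ b ∈ B,
      mass S s x ≤ (1 + 10 * κ) * mass S s b := by
    intro n
    induction n with
    | zero =>
      intro s hs x b hb
      have h1 := h.mass_basin_lower (hs.trans (by simp)) hb
      have h2 := h.mass_le s x
      nlinarith
    | succ n ih =>
      intro s hs x b hb
      rcases le_total s (2 * R) with hs2 | hs2
      · have h1 := h.mass_basin_lower hs2 hb
        have h2 := h.mass_le s x
        nlinarith
      · obtain ⟨u, rfl⟩ := exists_add_of_le hs2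
        have e : 2 * R + u = u + R + R := by ring
        rw [e] at hs ⊢
        have hs' : u + R ≤ n * R := by
          push_cast at hs
          rw [add_mul, one_mul] at hs
          exact le_of_add_le_add_right hs
        -- Since κ is at most 1/100, `1 + 10 * κ` is below 2, so the output of the step feeds its
        -- own hypothesis and the constant does not grow with `n`.
        have two : ∀ s ≤ n * R, ∀ x, ∀ b ∈ B, mass S s x ≤ 2 * mass S s b :=
          fun s hs x b hb => (ih s hs x b hb).trans <| by
            have := h.mass_nonneg s b
            nlinarith
        exact h.mass_le_basin_step (two u (le_self_add.trans hs')) (two _ hs') x hb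
  obtain ⟨n, hn⟩ := h.exists_nat_mul_ge s
  exact key n s hn x b hb

lemma mass_le_two_mul_basin (s : ℝ≥0) (x : 𝒳) {b : 𝒳} (hb : b ∈ B) :
    mass S s x ≤ 2 * mass S s b := by
  have := h.mass_le_basin s x hb
  have := h.mass_nonneg s b
  have := h.κ_le
  nlinarith

lemma mass_add_ge (s : ℝ≥0) (x : 𝒳) (n : ℕ) {t : ℝ≥0} (ht : t ≤ n * R) {b : 𝒳} (hb : b ∈ B) :
    (1 - 2 * κ) ^ n * mass S s x ≤ 2 * mass S (s + t) b := by
  have := h.mass_basin_iterate (s := s) (M := mass S s x / 2)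
    (fun b hb => by linarith [h.mass_le_two_mul_basin s x hb])
    (by linarith [h.mass_nonneg s x]) n ht hb
  linarith

end

/-- The mean of `φ` under the normalized kernel started at `x`. -/
def normalizedMean (S : ℝ≥0 → Matrix 𝒳 𝒳 ℝ) (x : 𝒳) (φ : 𝒳 → ℝ) (t : ℝ≥0) : ℝ :=
  (S t *ᵥ φ) x / mass S t x

section

variable (h : IsReturnKernel S B q R κ)
include h

lemma abs_mulVec_le (t : ℝ≥0) {φ : 𝒳 → ℝ} {H : ℝ} (hφ : ∀ y, |φ y| ≤ H) (x : 𝒳) :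
    |(S t *ᵥ φ) x| ≤ H * mass S t x := by
  rw [mulVec, dotProduct, mass, Finset.mul_sum]
  refine (Finset.abs_sum_le_sum_abs _ _).trans (Finset.sum_le_sum fun y _ => ?_)
  rw [abs_mul, abs_of_nonneg (h.nonneg _ _ _), mul_comm]
  exact mul_le_mul_of_nonneg_right (hφ y) (h.nonneg _ _ _)

lemma abs_mulVec_two_le {φ : 𝒳 → ℝ} {β D : ℝ} (hβ : ∀ y ∈ B, |φ y| ≤ β) (hD : ∀ y, |φ y| ≤ D)
    (x : 𝒳) : |(S (2 * R) *ᵥ φ) x| ≤ β + κ * D := by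
  obtain ⟨b, hb⟩ := h.nonempty
  have hβ0 : 0 ≤ β := (abs_nonneg _).trans (hβ b hb)
  have hD0 : 0 ≤ D := (abs_nonneg _).trans (hD b)
  calc |(S (2 * R) *ᵥ φ) x| ≤ ∑ y, (S (2 * R) x y * β + Bᶜ.indicator (S (2 * R) x) y * D) := by
        rw [mulVec, dotProduct]
        refine (Finset.abs_sum_le_sum_abs _ _).trans (Finset.sum_le_sum fun y _ => ?_)
        have h0 := h.nonneg (2 * R) x y
        rw [abs_mul, abs_of_nonneg h0]
        by_cases hy : y ∈ B
        · simpa [hy] using mul_le_mul_of_nonneg_left (hβ y hy) h0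
        · simp only [Set.indicator, Set.mem_compl_iff, hy, not_false_eq_true, if_true]
          nlinarith [hD y, mul_nonneg h0 hβ0, mul_le_mul_of_nonneg_left (hD y) h0]
    _ = mass S (2 * R) x * β + (∑ y, Bᶜ.indicator (S (2 * R) x) y) * D := by
        rw [Finset.sum_add_distrib, ← Finset.sum_mul, ← Finset.sum_mul, mass]
    _ ≤ β + κ * D := by
        have h1 := h.leave x
        have h2 := h.mass_le (2 * R) x
        exact add_le_add (mul_le_of_le_one_left hβ0 h2) (mul_le_mul_of_nonneg_right h1 hD0)

lemma abs_mulVec_two_sub_le {φ : 𝒳 → ℝ} {D : ℝ} (hD : ∀ y, |φ y| ≤ D) {x x' : 𝒳} (hx : x ∈ B)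
    (hx' : x' ∈ B) : |(S (2 * R) *ᵥ φ) x - (S (2 * R) *ᵥ φ) x'| ≤ 2 * κ * D := by
  rw [two_mul, h.add, ← mulVec_mulVec]
  refine h.abs_mulVec_sub_le (fun y => (h.abs_mulVec_le R hD y).trans ?_) hx hx'
  exact mul_le_of_le_one_right ((abs_nonneg _).trans (hD x)) (h.mass_le _ _)

lemma abs_normalizedMean_le {φ : 𝒳 → ℝ} (hφ : ∀ y, |φ y| ≤ 1) {x₀ : 𝒳} (hx₀ : x₀ ∈ B)
    (t : ℝ≥0) : |normalizedMean S x₀ φ t| ≤ 1 := by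
  have := h.mass_basin_pos hx₀ t
  rw [normalizedMean, abs_div, abs_of_pos this, div_le_one this]
  simpa using h.abs_mulVec_le t hφ x₀

/-- Two error levels are carried, `e` on `B` and `10 * e` everywhere. Off `B` there is no
thermalization, but after a time `2 * R` the kernel charges the complement of `B` by at most κ, so
the large error enters with weight κ. On `B` thermalization makes the difference with `x₀` of order
κ. Both levels are thereby halved. -/
lemma deviation_contracts {φ : 𝒳 → ℝ} {x₀ : 𝒳} (hx₀ : x₀ ∈ B) (t : ℝ≥0) {e : ℝ}
    (hB : ∀ x ∈ B, |(S t *ᵥ φ) x - normalizedMean S x₀ φ t * mass S t x| ≤ e)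
    (hA : ∀ x, |(S t *ᵥ φ) x - normalizedMean S x₀ φ t * mass S t x| ≤ 10 * e) (x : 𝒳) :
    |(S (2 * R + t) *ᵥ φ) x - normalizedMean S x₀ φ (2 * R + t) * mass S (2 * R + t) x|
      ≤ 10 * (e / 2) ∧ (x ∈ B →
    |(S (2 * R + t) *ᵥ φ) x - normalizedMean S x₀ φ (2 * R + t) * mass S (2 * R + t) x|
      ≤ e / 2) := by
  have hκ := h.κ_nonneg
  have hκ' := h.κ_le
  set a := normalizedMean S x₀ φ t with ha
  set ψ : 𝒳 → ℝ := fun x => (S t *ᵥ φ) x - a * mass S t x with hψ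
  have he : 0 ≤ e := (abs_nonneg _).trans (hB x₀ hx₀)
  have hpos := h.mass_basin_pos hx₀ (2 * R + t)
  have hWψ : ∀ y, (S (2 * R) *ᵥ ψ) y = (S (2 * R + t) *ᵥ φ) y - a * mass S (2 * R + t) y := by
    intro y
    have : ψ = S t *ᵥ φ - a • mass S t := by ext; simp [hψ]
    rw [this, mulVec_sub, mulVec_smul, ← mulVec_one_eq_mass, mulVec_mulVec, mulVec_mulVec,
      ← h.add, mulVec_one_eq_mass]
    simp
  set w := (S (2 * R) *ᵥ ψ) x₀ with hw
  -- The deviation is recentred at `x₀`: the normalized mean moves by `w / mass S (2 * R + t) x₀`.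
  have hnew : ∀ y, (S (2 * R + t) *ᵥ φ) y - normalizedMean S x₀ φ (2 * R + t) *
      mass S (2 * R + t) y = (S (2 * R) *ᵥ ψ) y -
        w * (mass S (2 * R + t) y / mass S (2 * R + t) x₀) := by
    intro y
    rw [hw, hWψ, hWψ, normalizedMean]
    field_simp
    ring
  have hwb : ∀ y, |(S (2 * R) *ᵥ ψ) y| ≤ 1.1 * e := fun y => by
    have := h.abs_mulVec_two_le hB hA y
    refine this.trans ?_
    nlinarith
  have hratio : ∀ y, mass S (2 * R + t) y / mass S (2 * R + t) x₀ ≤ 1 + 10 * κ := fun y => by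
    rw [div_le_iff₀ hpos]; exact h.mass_le_basin _ _ hx₀
  have hratio0 : ∀ y, 0 ≤ mass S (2 * R + t) y / mass S (2 * R + t) x₀ := fun y =>
    div_nonneg (h.mass_nonneg _ _) hpos.le
  rw [hnew]
  constructor
  · calc _ ≤ |(S (2 * R) *ᵥ ψ) x| + |w| * (mass S (2 * R + t) x / mass S (2 * R + t) x₀) := by
          refine (abs_sub _ _).trans ?_
          rw [abs_mul, abs_of_nonneg (hratio0 x)]
      _ ≤ 1.1 * e + 1.1 * e * 1.1 := by
          gcongr
          · exact hwb x
          · exact hratio0 x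
          · exact hwb x₀
          · linarith [hratio x]
      _ ≤ 10 * (e / 2) := by linarith
  · intro hx
    have hlow : 1 - 10 * κ ≤ mass S (2 * R + t) x / mass S (2 * R + t) x₀ := by
      rw [le_div_iff₀ hpos]
      have h1 := h.mass_le_basin (2 * R + t) x₀ hx
      have h2 := mul_le_mul_of_nonneg_left h1 (show 0 ≤ 1 - 10 * κ by linarith)
      nlinarith [mul_nonneg (sq_nonneg κ) (h.mass_nonneg (2 * R + t) x)]
    have hdist : |1 - mass S (2 * R + t) x / mass S (2 * R + t) x₀| ≤ 10 * κ := by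
      rw [abs_le]; constructor <;> linarith [hratio x]
    have h2 := h.abs_mulVec_two_sub_le hA hx hx₀
    calc |(S (2 * R) *ᵥ ψ) x - w * (mass S (2 * R + t) x / mass S (2 * R + t) x₀)|
        = |((S (2 * R) *ᵥ ψ) x - w) + w * (1 - mass S (2 * R + t) x / mass S (2 * R + t) x₀)| := by
          congr 1; ring
      _ ≤ 2 * κ * (10 * e) + 1.1 * e * (10 * κ) := by
          refine (abs_add_le _ _).trans (add_le_add h2 ?_)
          rw [abs_mul]
          gcongr
          exact hwb x₀
      _ ≤ e / 2 := by nlinarith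

/-- Up to an exponentially small error the normalized kernel forgets its starting point. -/
lemma abs_deviation_le {φ : 𝒳 → ℝ} (hφ : ∀ y, |φ y| ≤ 1) {x₀ : 𝒳} (hx₀ : x₀ ∈ B) (n : ℕ)
    {t : ℝ≥0} (ht : n * (2 * R) ≤ t) (x : 𝒳) :
    |(S t *ᵥ φ) x - normalizedMean S x₀ φ t * mass S t x| ≤ 20 * (1 / 2) ^ n := by
  have key : ∀ n : ℕ, ∀ u : ℝ≥0,
      (∀ x, |(S (n * (2 * R) + u) *ᵥ φ) x - normalizedMean S x₀ φ (n * (2 * R) + u) *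
        mass S (n * (2 * R) + u) x| ≤ 10 * (2 * (1 / 2) ^ n)) ∧
      (∀ x ∈ B, |(S (n * (2 * R) + u) *ᵥ φ) x - normalizedMean S x₀ φ (n * (2 * R) + u) *
        mass S (n * (2 * R) + u) x| ≤ 2 * (1 / 2) ^ n) := by
    intro n
    induction n with
    | zero =>
      intro u
      have : ∀ x, |(S u *ᵥ φ) x - normalizedMean S x₀ φ u * mass S u x| ≤ 2 := by
        intro x
        refine (abs_sub _ _).trans ?_
        have h1 := h.abs_mulVec_le u hφ x
        have h2 := h.abs_normalizedMean_le hφ hx₀ u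
        rw [abs_mul, abs_of_nonneg (h.mass_nonneg u x)]
        nlinarith [h.mass_nonneg u x, h.mass_le u x]
      simp only [Nat.cast_zero, zero_mul, zero_add, pow_zero, mul_one]
      exact ⟨fun x => (this x).trans (by norm_num), fun x _ => this x⟩
    | succ n ih =>
      intro u
      have e : ((n + 1 : ℕ) : ℝ≥0) * (2 * R) + u = 2 * R + (n * (2 * R) + u) := by
        push_cast; ring
      have e' : (2 : ℝ) * (1 / 2) ^ (n + 1) = 2 * (1 / 2) ^ n / 2 := by ring
      rw [e, e']
      exact ⟨fun x => (h.deviation_contracts hx₀ _ (ih u).2 (ih u).1 x).1,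
        fun x hx => (h.deviation_contracts hx₀ _ (ih u).2 (ih u).1 x).2 hx⟩
  obtain ⟨u, rfl⟩ := exists_add_of_le ht
  refine ((key n u).1 x).trans (le_of_eq (by ring))

end

end IsReturnKernel

end HittingTime

end

noncomputable section

/-! ### The quasi-stationary law and comparison with its survival probability. -/

namespace HittingTime

open Matrix

/-- The survival probability at time `t` under the initial law `μ`. -/
def decay {𝒳 : Type*} [Fintype 𝒳] (S : ℝ≥0 → Matrix 𝒳 𝒳 ℝ) (μ : 𝒳 → ℝ) (t : ℝ≥0) : ℝ :=
  ∑ z, μ z * mass S t z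

/-- `μ` is a probability vector which is an eigenvector of the semigroup `S`. -/
structure IsEigenLaw {𝒳 : Type*} [Fintype 𝒳] (S : ℝ≥0 → Matrix 𝒳 𝒳 ℝ) (μ : 𝒳 → ℝ) : Prop where
  nonneg : ∀ y, 0 ≤ μ y
  sum_one : ∑ y, μ y = 1
  eigen : ∀ u y, ∑ z, μ z * S u z y = decay S μ u * μ y

lemma IsEigenLaw.decay_le {𝒳 : Type*} [Fintype 𝒳] {S : ℝ≥0 → Matrix 𝒳 𝒳 ℝ} {μ : 𝒳 → ℝ}
    (hμ : IsEigenLaw S μ) (s : ℝ≥0) {U : ℝ} (hU : ∀ x, mass S s x ≤ U) : decay S μ s ≤ U := by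
  calc decay S μ s ≤ ∑ z, μ z * U :=
        Finset.sum_le_sum fun z _ => mul_le_mul_of_nonneg_left (hU z) (hμ.nonneg z)
    _ = U := by rw [← Finset.sum_mul, hμ.sum_one, one_mul]

namespace IsReturnKernel

variable {𝒳 : Type*} [Fintype 𝒳] {S : ℝ≥0 → Matrix 𝒳 𝒳 ℝ} {B : Set 𝒳}
  {q : 𝒳 → ℝ} {R : ℝ≥0} {κ : ℝ}

section

variable (h : IsReturnKernel S B q R κ)
include h

/-- Deviations shrink like `(1 / 2) ^ n` while the normalizing mass shrinks no faster than `(9 / 10)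
^ n`; the ratio 5/9 is below 1, so the error still vanishes after dividing. -/
lemma abs_mean_sub_le {φ : 𝒳 → ℝ} (hφ : ∀ y, |φ y| ≤ 1) {x₀ : 𝒳} (hx₀ : x₀ ∈ B) {ν : 𝒳 → ℝ}
    (hν : ∀ x, 0 ≤ ν x) {n : ℕ} {t : ℝ≥0} (ht : n * (2 * R) ≤ t) {c : ℝ} (hc : 0 < c)
    (hZ : 0 < ∑ x, ν x) (hW : c * (9 / 10) ^ (n + 1) * ∑ x, ν x ≤ ∑ x, ν x * mass S t x) :
    |(∑ x, ν x * (S t *ᵥ φ) x) / (∑ x, ν x * mass S t x) - normalizedMean S x₀ φ t|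
      ≤ 25 / c * (5 / 9) ^ n := by
  set Z := ∑ x, ν x
  set W := ∑ x, ν x * mass S t x with hWdef
  have hp : 0 < c * (9 / 10 : ℝ) ^ (n + 1) := by positivity
  have hWpos : 0 < W := lt_of_lt_of_le (mul_pos hp hZ) hW
  have h1 : |(∑ x, ν x * (S t *ᵥ φ) x) - normalizedMean S x₀ φ t * W| ≤ 20 * (1 / 2) ^ n * Z := by
    have : (∑ x, ν x * (S t *ᵥ φ) x) - normalizedMean S x₀ φ t * W =
        ∑ x, ν x * ((S t *ᵥ φ) x - normalizedMean S x₀ φ t * mass S t x) := by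
      rw [hWdef, Finset.mul_sum, ← Finset.sum_sub_distrib]
      exact Finset.sum_congr rfl fun x _ => by ring
    rw [this, Finset.mul_sum]
    refine (Finset.abs_sum_le_sum_abs _ _).trans (Finset.sum_le_sum fun x _ => ?_)
    rw [abs_mul, abs_of_nonneg (hν x), mul_comm]
    exact mul_le_mul_of_nonneg_right (h.abs_deviation_le hφ hx₀ n ht x) (hν x)
  have h2 : (∑ x, ν x * (S t *ᵥ φ) x) / W - normalizedMean S x₀ φ t =
      ((∑ x, ν x * (S t *ᵥ φ) x) - normalizedMean S x₀ φ t * W) / W := by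
    field_simp
  rw [h2, abs_div, abs_of_pos hWpos, div_le_iff₀ hWpos]
  refine h1.trans ?_
  have h3 : 25 / c * (5 / 9) ^ n * (c * (9 / 10) ^ (n + 1) * Z) ≤ 25 / c * (5 / 9) ^ n * W := by
    gcongr
  refine le_trans ?_ h3
  have h4 : (25 : ℝ) / c * (5 / 9) ^ n * (c * (9 / 10) ^ (n + 1) * Z) = 22.5 * (1 / 2) ^ n * Z := by
    have : (1 / 2 : ℝ) ^ n = (5 / 9) ^ n * (9 / 10) ^ n := by
      rw [← mul_pow]; norm_num
    rw [this, pow_succ]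
    field_simp
    norm_num
  rw [h4]
  gcongr
  norm_num

lemma floor_bounds (t : ℝ≥0) : (⌊t / (2 * R)⌋₊ : ℝ≥0) * (2 * R) ≤ t ∧
    t ≤ ((2 * (⌊t / (2 * R)⌋₊ + 1) : ℕ) : ℝ≥0) * R := by
  have hR : 0 < 2 * R := mul_pos two_pos h.R_pos
  constructor
  · rw [← le_div_iff₀ hR]
    exact Nat.floor_le zero_le
  · have := (Nat.lt_floor_add_one (t / (2 * R))).le
    rw [div_le_iff₀ hR] at this
    refine this.trans (le_of_eq ?_)
    push_cast
    ring

lemma mass_add_ge_floor (s t : ℝ≥0) (x : 𝒳) {b : 𝒳} (hb : b ∈ B) :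
    (9 / 10) ^ (⌊t / (2 * R)⌋₊ + 1) * mass S s x ≤ 2 * mass S (s + t) b := by
  have hκ := h.κ_nonneg
  have hκ' := h.κ_le
  refine le_trans ?_ (h.mass_add_ge s x _ (h.floor_bounds t).2 hb)
  rw [pow_mul]
  refine mul_le_mul_of_nonneg_right (pow_le_pow_left₀ (by norm_num) ?_ _) (h.mass_nonneg _ _)
  -- Here `(1 - 2 * κ) ^ 2` is at least 9/10; the square appears because `n` counts periods `2 * R`.
  nlinarith

lemma tendsto_error (c : ℝ) :
    Tendsto (fun t : ℝ≥0 => 25 / c * (5 / 9 : ℝ) ^ ⌊t / (2 * R)⌋₊) atTop (𝓝 0) := by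
  have hR : 0 < 2 * R := mul_pos two_pos h.R_pos
  have h1 : Tendsto (fun t : ℝ≥0 => ⌊t / (2 * R)⌋₊) atTop atTop :=
    tendsto_nat_floor_atTop.comp (tendsto_id.atTop_div_const hR)
  have h2 := (tendsto_pow_atTop_nhds_zero_of_lt_one (r := (5 / 9 : ℝ)) (by norm_num)
    (by norm_num)).comp h1
  simpa using h2.const_mul (25 / c)

/-- The first stretch `s` is regarded as a change of initial law, from `x₀` to `S s x₀`, which is
then forgotten during `t`. The bound is uniform in `s`, hence the Cauchy property. -/
lemma abs_normalizedMean_add_sub_le {φ : 𝒳 → ℝ} (hφ : ∀ y, |φ y| ≤ 1) {x₀ : 𝒳} (hx₀ : x₀ ∈ B)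
    (s t : ℝ≥0) : |normalizedMean S x₀ φ (s + t) - normalizedMean S x₀ φ t|
      ≤ 25 / (1 / 2) * (5 / 9) ^ ⌊t / (2 * R)⌋₊ := by
  have hW : ∑ x, S s x₀ x * mass S t x = mass S (s + t) x₀ := (h.mass_add s t x₀).symm
  have hφ' : ∑ x, S s x₀ x * (S t *ᵥ φ) x = (S (s + t) *ᵥ φ) x₀ := by
    rw [h.add, ← mulVec_mulVec]; rfl
  have := h.abs_mean_sub_le hφ hx₀ (ν := S s x₀) (fun x => h.nonneg _ _ _)
    (h.floor_bounds t).1 (c := 1 / 2) (by norm_num) (h.mass_basin_pos hx₀ s) (by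
      rw [hW]
      have := h.mass_add_ge_floor s t x₀ hx₀
      rw [mass] at this
      linarith)
  rwa [hW, hφ'] at this

lemma exists_tendsto_normalizedMean {φ : 𝒳 → ℝ} (hφ : ∀ y, |φ y| ≤ 1) {x₀ : 𝒳} (hx₀ : x₀ ∈ B) :
    ∃ l, Tendsto (normalizedMean S x₀ φ) atTop (𝓝 l) := by
  refine cauchySeq_tendsto_of_complete (Metric.cauchySeq_iff'.mpr fun ε hε => ?_)
  obtain ⟨N, hN⟩ := ((h.tendsto_error (1 / 2)).eventually (gt_mem_nhds hε)).exists
  refine ⟨N, fun t ht => ?_⟩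
  obtain ⟨s, rfl⟩ := exists_add_of_le ht
  rw [Real.dist_eq, add_comm]
  exact (h.abs_normalizedMean_add_sub_le hφ hx₀ s N).trans_lt hN

/-- All initial laws which survive as well as the points of `B` have the same limit. -/
lemma tendsto_mean {φ : 𝒳 → ℝ} (hφ : ∀ y, |φ y| ≤ 1) {x₀ : 𝒳} (hx₀ : x₀ ∈ B) {l : ℝ}
    (hl : Tendsto (normalizedMean S x₀ φ) atTop (𝓝 l)) {ν : 𝒳 → ℝ} (hν : ∀ x, 0 ≤ ν x)
    (hZ : ∑ x, ν x = 1) {c : ℝ} (hc : 0 < c)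
    (hW : ∀ t, c * mass S t x₀ ≤ ∑ x, ν x * mass S t x) :
    Tendsto (fun t => (∑ x, ν x * (S t *ᵥ φ) x) / (∑ x, ν x * mass S t x)) atTop (𝓝 l) := by
  have hκ' := h.κ_le
  have h1 : Tendsto (fun t => (∑ x, ν x * (S t *ᵥ φ) x) / (∑ x, ν x * mass S t x) -
      normalizedMean S x₀ φ t) atTop (𝓝 0) := by
    refine squeeze_zero_norm (fun t => ?_) (h.tendsto_error (c / 4))
    rw [Real.norm_eq_abs]
    refine h.abs_mean_sub_le hφ hx₀ hν (h.floor_bounds t).1 (by positivity)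
      (by rw [hZ]; norm_num) ?_
    rw [hZ, mul_one]
    refine le_trans ?_ (hW t)
    have h2 := h.mass_add_ge_floor 0 t x₀ hx₀
    have h3 := h.mass_basin_lower (s := 0) zero_le hx₀
    rw [zero_add] at h2
    have h4 : (0 : ℝ) ≤ (9 / 10) ^ (⌊t / (2 * R)⌋₊ + 1) := by positivity
    have h5 : (9 / 10) ^ (⌊t / (2 * R)⌋₊ + 1) ≤ 4 * mass S t x₀ := by nlinarith
    nlinarith
  simpa using h1.add hl

/-- Existence of the quasi-stationary law. -/
lemma exists_quasiStationary :
    ∃ μ : 𝒳 → ℝ, IsEigenLaw S μ ∧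
      (∀ n : ℕ, (1 - 2 * κ) ^ n ≤ 2 * decay S μ (n * R)) ∧
      ∀ ν : 𝒳 → ℝ, (∀ x, 0 ≤ ν x) → ∑ x, ν x = 1 →
        ∀ c > 0, ∀ b ∈ B, (∀ t, c * mass S t b ≤ ∑ x, ν x * mass S t x) →
        ∀ y, Tendsto (fun t => (∑ x, ν x * S t x y) / (∑ x, ν x * mass S t x)) atTop (𝓝 (μ y)) := by
  classical
  obtain ⟨x₀, hx₀⟩ := h.nonempty
  have hsingle : ∀ y z : 𝒳, |(Pi.single y (1 : ℝ) : 𝒳 → ℝ) z| ≤ 1 := by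
    intro y z
    by_cases hz : z = y
    · subst hz; simp
    · simp [Pi.single_eq_of_ne hz]
  have happ : ∀ t x y, (S t *ᵥ Pi.single y 1) x = S t x y := fun t x y => by simp
  choose μ hμ using fun y => h.exists_tendsto_normalizedMean (hsingle y) hx₀
  have hμ' : ∀ y, Tendsto (fun t => S t x₀ y / mass S t x₀) atTop (𝓝 (μ y)) := fun y => by
    refine (hμ y).congr fun t => ?_
    rw [normalizedMean, happ]
  have hsum : ∑ y, μ y = 1 := by
    refine tendsto_nhds_unique (tendsto_finsetSum Finset.univ fun y _ => hμ' y) ?_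
    refine tendsto_const_nhds.congr fun t => ?_
    rw [← Finset.sum_div, ← mass, div_self (h.mass_basin_pos hx₀ t).ne']
  have hdecay : ∀ u, Tendsto (fun t => mass S (t + u) x₀ / mass S t x₀) atTop
      (𝓝 (∑ z, μ z * mass S u z)) := fun u => by
    refine (tendsto_finsetSum Finset.univ fun z _ => (hμ' z).mul_const (mass S u z)).congr
      fun t => ?_
    rw [h.mass_add, Finset.sum_div]
    exact Finset.sum_congr rfl fun z _ => by ring
  refine ⟨μ, ⟨fun y => ?_, hsum, fun u y => ?_⟩, fun n => ?_, ?_⟩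
  · exact ge_of_tendsto' (hμ' y) fun t => div_nonneg (h.nonneg _ _ _) (h.mass_nonneg _ _)
  · have h1 : Tendsto (fun t => S (t + u) x₀ y / mass S t x₀) atTop
        (𝓝 (∑ z, μ z * S u z y)) := by
      refine (tendsto_finsetSum Finset.univ fun z _ => (hμ' z).mul_const (S u z y)).congr
        fun t => ?_
      rw [h.add, mul_apply, Finset.sum_div]
      exact Finset.sum_congr rfl fun z _ => by ring
    refine tendsto_nhds_unique h1 ?_
    -- The same limit computed by normalizing at `t + u` instead of `t`; uniqueness of limits gives
    -- the eigenvector equation.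
    have h2 := (hdecay u).mul ((hμ' y).comp
      (tendsto_atTop_mono (fun t => le_self_add (b := u)) tendsto_id))
    refine h2.congr fun t => ?_
    have := (h.mass_basin_pos hx₀ t).ne'
    have := (h.mass_basin_pos hx₀ (t + u)).ne'
    simp only [Function.comp_apply, id_eq]
    field_simp
  · refine ge_of_tendsto' ((hdecay (n * R)).const_mul 2) fun t => ?_
    rw [← mul_div_assoc, le_div_iff₀ (h.mass_basin_pos hx₀ t)]
    exact h.mass_add_ge t x₀ n le_rfl hx₀
  · intro ν hν hZ c hc b hb hW y
    have hW' : ∀ t, c / 2 * mass S t x₀ ≤ ∑ x, ν x * mass S t x := fun t => by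
      refine le_trans ?_ (hW t)
      nlinarith [h.mass_le_two_mul_basin t x₀ hb]
    simpa only [happ] using h.tendsto_mean (hsingle y) hx₀ (hμ y) hν hZ (half_pos hc) hW'

variable {μ : 𝒳 → ℝ} (hμ : IsEigenLaw S μ)
include hμ

lemma decay_add (u v : ℝ≥0) : decay S μ (u + v) = decay S μ u * decay S μ v := by
  calc decay S μ (u + v) = ∑ z, ∑ y, μ z * (S u z y * mass S v y) := by
        simp only [decay, h.mass_add, Finset.mul_sum]
    _ = ∑ y, (∑ z, μ z * S u z y) * mass S v y := by
        rw [Finset.sum_comm]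
        simp only [Finset.sum_mul, mul_assoc]
    _ = decay S μ u * decay S μ v := by
        simp only [hμ.eigen, mul_assoc, ← Finset.mul_sum]
        rfl

lemma decay_anti {u v : ℝ≥0} (huv : u ≤ v) : decay S μ v ≤ decay S μ u :=
  Finset.sum_le_sum fun z _ => mul_le_mul_of_nonneg_left (h.mass_anti huv z) (hμ.nonneg z)

lemma decay_nonneg (u : ℝ≥0) : 0 ≤ decay S μ u :=
  Finset.sum_nonneg fun z _ => mul_nonneg (hμ.nonneg z) (h.mass_nonneg u z)

/-- Exponents start at one because `S 0` is not assumed to be the identity (killing already acts at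
time 0). -/
lemma decay_nat_mul (n : ℕ) (u : ℝ≥0) : decay S μ ((n + 1 : ℕ) * u) = decay S μ u ^ (n + 1) := by
  induction n with
  | zero => simp
  | succ n ih =>
    rw [Nat.cast_succ, add_mul, one_mul, h.decay_add hμ, ih, pow_succ _ (n + 1)]

variable (hdec : ∀ n : ℕ, (1 - 2 * κ) ^ n ≤ 2 * decay S μ (n * R))
include hdec

/-- The constant 2 in `hdec` disappears by multiplicativity: a smaller value at `R` would make the
ratio of the `n`-th powers tend to zero, below 1/2. -/
lemma decay_R_ge : 1 - 2 * κ ≤ decay S μ R := by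
  by_contra! hlt
  have hκ' := h.κ_le
  have h0 : 0 < 1 - 2 * κ := by linarith
  have hρ : decay S μ R / (1 - 2 * κ) < 1 := by rwa [div_lt_one h0]
  have hρ0 : 0 ≤ decay S μ R / (1 - 2 * κ) := div_nonneg (h.decay_nonneg hμ R) h0.le
  obtain ⟨n, hn⟩ := exists_pow_lt_of_lt_one (show (0 : ℝ) < 1 / 2 by norm_num) hρ
  have h1 := hdec (n + 1)
  rw [h.decay_nat_mul hμ] at h1
  have h2 : 1 / 2 ≤ (decay S μ R / (1 - 2 * κ)) ^ (n + 1) := by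
    rw [div_pow, le_div_iff₀ (pow_pos h0 _)]
    linarith
  have h3 := pow_le_pow_of_le_one hρ0 hρ.le (Nat.le_succ n)
  exact absurd (h2.trans h3) (not_le.mpr hn)

/-- From μ the basin is visited within time `R` with probability at least `1 - 3 * κ`, and every
point of the basin survives at least as well as `x` up to `1 + 10 * κ`. -/
lemma mass_le_decay (s : ℝ≥0) (x : 𝒳) : mass S s x ≤ (1 + 20 * κ) * decay S μ s := by
  have hκ := h.κ_nonneg
  have hκ' := h.κ_le
  have hR := h.decay_R_ge hμ hdec
  have g0 := h.mass_nonneg s x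
  have g1 := h.mass_le s x
  have hE := h.decay_nonneg hμ s
  rcases le_total s R with hs | hs
  · have := h.decay_anti hμ hs
    nlinarith
  · obtain ⟨u, rfl⟩ := exists_add_of_le hs
    rw [add_comm R u] at *
    set M := mass S (u + R) x / (1 + 10 * κ) with hM
    have hk : 0 < 1 + 10 * κ := by linarith
    have hM0 : 0 ≤ M := div_nonneg g0 hk.le
    have hlow : ∀ b' ∈ B, M ≤ mass S (u + R) b' := fun b' hb' => by
      rw [hM, div_le_iff₀ hk, mul_comm]
      exact h.mass_le_basin _ _ hb'
    have h1 : ∑ z, μ z * ((mass S R z - κ) * M) ≤ decay S μ (u + R) :=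
      Finset.sum_le_sum fun z _ => mul_le_mul_of_nonneg_left
        ((mul_le_mul_of_nonneg_right (h.ret z) hM0).trans (h.lower u z M hlow)) (hμ.nonneg z)
    have h2 : ∑ z, μ z * ((mass S R z - κ) * M) = (decay S μ R - κ) * M := by
      have : ∀ z, μ z * ((mass S R z - κ) * M) = (μ z * mass S R z) * M - μ z * (κ * M) :=
        fun z => by ring
      simp only [this, Finset.sum_sub_distrib, ← Finset.sum_mul, hμ.sum_one]
      rw [decay]; ring
    rw [h2] at h1
    have h3 : mass S (u + R) x = (1 + 10 * κ) * M := by rw [hM]; field_simp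
    have h4 : (1 - 3 * κ) * M ≤ decay S μ (u + R) :=
      (mul_le_mul_of_nonneg_right (by linarith) hM0).trans h1
    have h5 : 1 + 10 * κ ≤ (1 + 20 * κ) * (1 - 3 * κ) := by nlinarith
    calc mass S (u + R) x = (1 + 10 * κ) * M := h3
      _ ≤ (1 + 20 * κ) * (1 - 3 * κ) * M := by gcongr
      _ = (1 + 20 * κ) * ((1 - 3 * κ) * M) := by ring
      _ ≤ (1 + 20 * κ) * decay S μ (u + R) := by gcongr

lemma abs_basin_sub_decay_le (s : ℝ≥0) {b : 𝒳} (hb : b ∈ B) :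
    |mass S s b - decay S μ s| ≤ 20 * κ * decay S μ s := by
  have hκ := h.κ_nonneg
  have hκ' := h.κ_le
  have h1 := h.mass_le_decay hμ hdec s b
  have h2 := hμ.decay_le s fun x => h.mass_le_basin s x hb
  have hE := h.decay_nonneg hμ s
  have g0 := h.mass_nonneg s b
  have hκE := mul_nonneg hκ hE
  have hκg := mul_nonneg hκ g0
  rw [abs_le]
  constructor <;> nlinarith

lemma abs_average_sub_decay_le (s : ℝ≥0) {ν : 𝒳 → ℝ} (hν : ∀ x, 0 ≤ ν x) (hZ : ∑ x, ν x = 1)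
    (hB : 1 - κ ≤ ∑ x, B.indicator ν x) :
    |∑ x, ν x * mass S s x - decay S μ s| ≤ 100 * κ * decay S μ s := by
  have hκ := h.κ_nonneg
  have hκ' := h.κ_le
  have hE := h.decay_nonneg hμ s
  have h1 : ∑ x, ν x * mass S s x ≤ (1 + 20 * κ) * decay S μ s := by
    calc _ ≤ ∑ x, ν x * ((1 + 20 * κ) * decay S μ s) :=
          Finset.sum_le_sum fun x _ =>
            mul_le_mul_of_nonneg_left (h.mass_le_decay hμ hdec s x) (hν x)
      _ = _ := by rw [← Finset.sum_mul, hZ, one_mul]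
  have h2 : (∑ x, B.indicator ν x) * ((1 - 20 * κ) * decay S μ s) ≤ ∑ x, ν x * mass S s x := by
    rw [Finset.sum_mul]
    refine Finset.sum_le_sum fun x _ => ?_
    by_cases hx : x ∈ B
    · rw [Set.indicator_of_mem hx]
      have := (abs_le.mp (h.abs_basin_sub_decay_le hμ hdec s hx)).1
      exact mul_le_mul_of_nonneg_left (by linarith) (hν x)
    · rw [Set.indicator_of_notMem hx, zero_mul]
      exact mul_nonneg (hν x) (h.mass_nonneg s x)
  have h3 : (1 - κ) * ((1 - 20 * κ) * decay S μ s) ≤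
      (∑ x, B.indicator ν x) * ((1 - 20 * κ) * decay S μ s) :=
    mul_le_mul_of_nonneg_right hB (mul_nonneg (by linarith) hE)
  have hκE := mul_nonneg hκ hE
  rw [abs_le]
  constructor <;> nlinarith [mul_nonneg hκ hκE]

/-- The upper bound restarts at the visit with only time `s` left, the lower bound with all of `s +
R`; the two differ by the factor `decay S μ R`, which is close to 1. The margin left for `p` lets
the probability of the theorem replace `q x`. -/
lemma abs_mass_sub_mul_decay_le (s : ℝ≥0) (x : 𝒳) {p : ℝ} (hp : q x * (1 - κ) ≤ p)
    (hp' : p ≤ q x) :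
    |mass S (s + R) x - p * decay S μ (s + R)| ≤ 100 * κ * decay S μ (s + R) := by
  have hκ := h.κ_nonneg
  have hκ' := h.κ_le
  have hE := h.decay_nonneg hμ (s + R)
  have hEs := h.decay_nonneg hμ s
  have hR := h.decay_R_ge hμ hdec
  have hq := h.q_le x
  have hq0 := h.q_nonneg x
  have hκE := mul_nonneg hκ hE
  have hκEs := mul_nonneg hκ hEs
  have hadd := h.decay_add hμ s R
  have hs : decay S μ s ≤ (1 + 3 * κ) * decay S μ (s + R) := by
    rw [hadd]
    have : 1 ≤ (1 + 3 * κ) * decay S μ R := by nlinarith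
    calc decay S μ s = decay S μ s * 1 := (mul_one _).symm
      _ ≤ decay S μ s * ((1 + 3 * κ) * decay S μ R) := by gcongr
      _ = _ := by ring
  have hup := h.upper s x _ _ (h.mass_le_decay hμ hdec s) (fun b hb => by
    have := (abs_le.mp (h.abs_basin_sub_decay_le hμ hdec s hb)).2
    show mass S s b ≤ (1 + 20 * κ) * decay S μ s
    linarith)
  have hlow := h.lower s x ((1 - 20 * κ) * decay S μ (s + R)) fun b hb => by
    have := (abs_le.mp (h.abs_basin_sub_decay_le hμ hdec (s + R) hb)).1
    linarith
  set E := decay S μ (s + R)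
  have hqp : q x ≤ p + κ := by nlinarith
  rw [abs_le]
  constructor
  · have : p * E - 20 * κ * E ≤ q x * ((1 - 20 * κ) * E) := by
      have h1 : p * E ≤ q x * E := mul_le_mul_of_nonneg_right hp' hE
      have h2 : q x * (κ * E) ≤ κ * E := mul_le_of_le_one_left hκE hq
      nlinarith
    nlinarith
  · have c1 : κ * (1 + 20 * κ) + q x * (1 + 20 * κ) ≤ q x + 22 * κ := by
      nlinarith [mul_nonneg hκ hq0, mul_le_of_le_one_left hκ hq]
    have c2 : (q x + 22 * κ) * (1 + 3 * κ) ≤ p + 50 * κ := by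
      nlinarith [mul_nonneg hκ hq0, mul_le_of_le_one_left hκ hq]
    calc mass S (s + R) x - p * E ≤
        (κ * (1 + 20 * κ) + q x * (1 + 20 * κ)) * decay S μ s - p * E := by linarith
      _ ≤ (q x + 22 * κ) * ((1 + 3 * κ) * E) - p * E := by gcongr
      _ = ((q x + 22 * κ) * (1 + 3 * κ)) * E - p * E := by ring
      _ ≤ (p + 50 * κ) * E - p * E := by gcongr
      _ ≤ 100 * κ * E := by linarith

end

end IsReturnKernel

end HittingTime

end

noncomputable section

/-! ### Dyadic grids and the Markov property of the killed chain. -/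

namespace HittingTime

/-- The `k`-th point of the dyadic grid of order `n` on `[0, T]`. -/
def gridPt (T : ℝ≥0) (n k : ℕ) : ℝ≥0 := k * (T / 2 ^ n)

lemma gridPt_succ (T : ℝ≥0) (n k : ℕ) : gridPt T (n + 1) (2 * k) = gridPt T n k := by
  simp only [gridPt, pow_succ]
  push_cast
  field_simp

lemma gridPt_pow (T : ℝ≥0) (n : ℕ) : gridPt T n (2 ^ n) = T := by
  simp only [gridPt]
  push_cast
  field_simp

lemma gridPt_mono (T : ℝ≥0) (n : ℕ) : Monotone (gridPt T n) := fun i j hij => by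
  unfold gridPt
  gcongr

lemma gridPt_le {T : ℝ≥0} {n k : ℕ} (hk : k ≤ 2 ^ n) : gridPt T n k ≤ T :=
  (gridPt_mono T n hk).trans_eq (gridPt_pow T n)

lemma exists_gridPt_mem_Ico {T u v : ℝ≥0} (huT : u < T) (huv : u < v) :
    ∃ n k, k ≤ 2 ^ n ∧ gridPt T n k ∈ Set.Ico u v := by
  have hT : 0 < T := lt_of_le_of_lt zero_le huT
  have hlim : Tendsto (fun n : ℕ => T * (1 / 2 : ℝ≥0) ^ n) atTop (𝓝 (T * 0)) := by
    refine (tendsto_const_nhds).mul ?_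
    rw [← NNReal.tendsto_coe]
    push_cast
    exact tendsto_pow_atTop_nhds_zero_of_lt_one (by norm_num) (by norm_num)
  rw [mul_zero] at hlim
  obtain ⟨n, hn⟩ := (hlim.eventually (gt_mem_nhds (tsub_pos_of_lt huv))).exists
  have hn' : T / 2 ^ n < v - u := by
    rwa [one_div, inv_pow, ← div_eq_mul_inv] at hn
  have hh : 0 < T / 2 ^ n := by positivity
  refine ⟨n, ⌈u / (T / 2 ^ n)⌉₊, ?_, ?_, ?_⟩
  · refine Nat.ceil_le.mpr ?_
    rw [div_le_iff₀ hh]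
    push_cast
    rw [mul_div_cancel₀ _ (by positivity)]
    exact huT.le
  · unfold gridPt
    rw [← div_le_iff₀ hh]
    exact Nat.le_ceil _
  · unfold gridPt
    have h1 : (⌈u / (T / 2 ^ n)⌉₊ : ℝ≥0) < u / (T / 2 ^ n) + 1 := Nat.ceil_lt_add_one zero_le
    calc (⌈u / (T / 2 ^ n)⌉₊ : ℝ≥0) * (T / 2 ^ n) < (u / (T / 2 ^ n) + 1) * (T / 2 ^ n) := by
          gcongr
      _ = u + T / 2 ^ n := by rw [add_mul, one_mul, div_mul_cancel₀ _ hh.ne']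
      _ < u + (v - u) := by gcongr
      _ = v := add_tsub_cancel_of_le huv.le

/-- A property which persists for a short time and holds somewhere in `[0, T]` holds at a grid
point. -/
lemma exists_gridPt_of_exists {T : ℝ≥0} {p : ℝ≥0 → Prop}
    (hp : ∀ u, p u → ∀ᶠ s in 𝓝[≥] u, p s) {u : ℝ≥0} (hu : u ≤ T) (hpu : p u) :
    ∃ n k, k ≤ 2 ^ n ∧ p (gridPt T n k) := by
  rcases hu.lt_or_eq with hlt | rfl
  · obtain ⟨v, hv, hsub⟩ := mem_nhdsGE_iff_exists_Ico_subset' (hlt) |>.mp (hp u hpu)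
    obtain ⟨n, k, hk, hmem⟩ := exists_gridPt_mem_Ico hlt hv
    exact ⟨n, k, hk, hsub hmem⟩
  · exact ⟨0, 1, by simp, by simpa [gridPt] using hpu⟩

variable {𝒳 Ω : Type*}

/-- Right-continuity in a discrete space keeps the path constant just after `t`, so the infimum
exceeds `t` strictly. -/
lemma coe_lt_hit_iff {X : ℝ≥0 → Ω → 𝒳} {ω : Ω}
    (hrc : ∀ t, ∀ᶠ s in 𝓝[≥] t, X s ω = X t ω) (K : Set 𝒳) (t : ℝ≥0) :
    (t : ℝ≥0∞) < hit X K ω ↔ ∀ s ≤ t, X s ω ∉ K := by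
  constructor
  · intro h s hs hmem
    have h1 : hit X K ω ≤ s := iInf₂_le s hmem
    exact absurd (h.trans_le h1) (not_lt.mpr (by exact_mod_cast hs))
  · intro h
    obtain ⟨v, hv, hsub⟩ := (mem_nhdsGE_iff_exists_Ico_subset' (lt_add_one t)).mp (hrc t)
    refine lt_of_lt_of_le (show (t : ℝ≥0∞) < (v : ℝ≥0∞) by exact_mod_cast hv) ?_
    refine le_iInf₂ fun s hs => ?_
    by_contra! hlt
    have hsv : s < v := by exact_mod_cast hlt
    rcases le_total s t with hst | hst
    · exact h s hst hs
    · have : X s ω = X t ω := hsub ⟨hst, hsv⟩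
      exact h t le_rfl (this ▸ hs)

lemma measurableSet_past {X : ℝ≥0 → Ω → 𝒳} {u s : ℝ≥0} (hu : u ≤ s) (F : Set 𝒳) :
    MeasurableSet[past X s] {ω | X u ω ∈ F} := by
  have h1 : MeasurableSpace.comap (X u) ⊤ ≤ past X s :=
    le_iSup (fun u : Set.Iic s => MeasurableSpace.comap (X u) ⊤) ⟨u, hu⟩
  exact h1 _ ⟨F, trivial, rfl⟩

lemma past_mono {X : ℝ≥0 → Ω → 𝒳} {s t : ℝ≥0} (hst : s ≤ t) : past X s ≤ past X t :=
  iSup_le fun u => le_iSup (fun u : Set.Iic t => MeasurableSpace.comap (X u) ⊤)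
    ⟨u, Set.mem_Iic.mpr (le_trans (Set.mem_Iic.mp u.2) hst)⟩

lemma measurableSet_grid_past (X : ℝ≥0 → Ω → 𝒳) (G : Set 𝒳) (s t : ℝ≥0) (n : ℕ) :
    MeasurableSet[past X (s + t)] {ω | ∀ k ≤ 2 ^ n, X (s + gridPt t n k) ω ∉ G} := by
  simp only [Set.ofPred_forall]
  refine MeasurableSet.iInter fun k => MeasurableSet.iInter fun hk => ?_
  exact measurableSet_past (by gcongr; exact gridPt_le hk) Gᶜ

lemma noHit_add_iff (X : ℝ≥0 → Ω → 𝒳) (G : Set 𝒳) (s t : ℝ≥0) (ω : Ω) :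
    (∀ u ≤ s + t, X u ω ∉ G) ↔ (∀ u ≤ s, X u ω ∉ G) ∧ ∀ u ≤ t, X (s + u) ω ∉ G := by
  constructor
  · exact fun h => ⟨fun u hu => h u (hu.trans le_self_add), fun u hu => h _ (by gcongr)⟩
  · rintro ⟨h1, h2⟩ u hu
    rcases le_total u s with hus | hus
    · exact h1 u hus
    · obtain ⟨v, rfl⟩ := exists_add_of_le hus
      exact h2 v (by simpa using hu)

variable [MeasurableSpace Ω]

/-- The transition kernel of the chain killed on `G`. -/
def killed (P : 𝒳 → Measure Ω) (X : ℝ≥0 → Ω → 𝒳) (G : Set 𝒳) (t : ℝ≥0) : Matrix 𝒳 𝒳 ℝ :=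
  Matrix.of fun x y => (P x).real {ω | X t ω = y ∧ (t : ℝ≥0∞) < hit X G ω}

lemma killed_nonneg (P : 𝒳 → Measure Ω) (X : ℝ≥0 → Ω → 𝒳) (G : Set 𝒳) (t : ℝ≥0) (x y : 𝒳) :
    0 ≤ killed P X G t x y := measureReal_nonneg

variable [Fintype 𝒳] [DecidableEq 𝒳]

namespace IsMarkovChain

variable {Q : Matrix 𝒳 𝒳 ℝ} {P : 𝒳 → Measure Ω} {X : ℝ≥0 → Ω → 𝒳}
  (hX : IsMarkovChain Q P X)
include hX

lemma measurableSet_mem (t : ℝ≥0) (F : Set 𝒳) : MeasurableSet {ω | X t ω ∈ F} := by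
  have : {ω | X t ω ∈ F} = ⋃ y ∈ F, {ω | X t ω = y} := by ext; simp
  rw [this]
  exact MeasurableSet.biUnion (Set.to_countable F) fun y _ => hX.meas t y

lemma past_le (s : ℝ≥0) : past X s ≤ ‹MeasurableSpace Ω› := by
  refine iSup_le fun u => ?_
  rintro _ ⟨F, -, rfl⟩
  exact hX.measurableSet_mem u F

lemma real_eq_sum (x : 𝒳) (t : ℝ≥0) (E : Set Ω) :
    (P x).real E = ∑ w, (P x).real (E ∩ {ω | X t ω = w}) := by
  have := hX.prob x
  have h1 := sum_measureReal_preimage_singleton (μ := (P x).restrict E) (f := X t) Finset.univ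
    (fun y _ => hX.meas t y)
  simp only [Finset.coe_univ, Set.preimage_univ, measureReal_restrict_apply_univ] at h1
  rw [← h1]
  refine Finset.sum_congr rfl fun w _ => ?_
  rw [measureReal_restrict_apply (show MeasurableSet (X t ⁻¹' {w}) from hX.meas t w),
    Set.inter_comm]
  rfl

lemma noHit_eq_iInter_grid (G : Set 𝒳) (s t : ℝ≥0) :
    {ω | ∀ u ≤ t, X (s + u) ω ∉ G} =
      ⋂ n, {ω | ∀ k ≤ 2 ^ n, X (s + gridPt t n k) ω ∉ G} := by
  ext ω
  simp only [Set.mem_ofPred_eq, Set.mem_iInter]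
  constructor
  · exact fun h n k hk => h _ (gridPt_le hk)
  · intro h u hu hmem
    obtain ⟨n, k, hk, hmem'⟩ := exists_gridPt_of_exists (p := fun u => X (s + u) ω ∈ G)
      (fun u hpu => by
        have h1 : Tendsto (fun v => s + v) (𝓝[≥] u) (𝓝[≥] (s + u)) := by
          refine tendsto_nhdsWithin_iff.mpr ⟨?_, ?_⟩
          · exact (continuous_const.add continuous_id).continuousAt.mono_left nhdsWithin_le_nhds
          · filter_upwards [self_mem_nhdsWithin] with v hv
            exact add_le_add_right hv s
        filter_upwards [h1.eventually (hX.rightCont ω (s + u))] with v hv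
        rw [hv]; exact hpu) hu hmem
    exact h n k hk hmem'

lemma measurableSet_noHit_past (G : Set 𝒳) (t : ℝ≥0) :
    MeasurableSet[past X t] {ω | ∀ u ≤ t, X u ω ∉ G} := by
  have h1 := hX.noHit_eq_iInter_grid G 0 t
  simp only [zero_add] at h1
  rw [h1]
  refine MeasurableSet.iInter fun n => ?_
  have h2 := measurableSet_grid_past X G 0 t n
  rw [zero_add] at h2
  simpa only [zero_add] using h2

end IsMarkovChain

/-- Transitions of the chain sampled at mesh `h` and killed on `G`. -/
def gridKernel (Q : Matrix 𝒳 𝒳 ℝ) (G : Set 𝒳) (h : ℝ≥0) : Matrix 𝒳 𝒳 ℝ :=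
  Matrix.of fun w z => Gᶜ.indicator (semigroup Q h w) z

namespace IsMarkovChain

variable {Q : Matrix 𝒳 𝒳 ℝ} {P : 𝒳 → Measure Ω} {X : ℝ≥0 → Ω → 𝒳}
  (hX : IsMarkovChain Q P X)
include hX

/-- `gridKernel` kills on arrival only, so the start must be outside `G` for the grid index 0 to be
accounted for. -/
lemma real_grid_eq (x : 𝒳) (G : Set 𝒳) {s : ℝ≥0} {y : 𝒳} (hy : y ∉ G) {E : Set Ω}
    (hE : MeasurableSet[past X s] E) (h : ℝ≥0) (N : ℕ) (z : 𝒳) :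
    (P x).real (E ∩ {ω | X s ω = y} ∩ {ω | ∀ k ≤ N, X (s + k * h) ω ∉ G} ∩
      {ω | X (s + N * h) ω = z}) =
    (P x).real (E ∩ {ω | X s ω = y}) * (gridKernel Q G h ^ N) y z := by
  induction N generalizing z with
  | zero =>
    rw [pow_zero]
    by_cases hz : y = z
    · subst hz
      rw [Matrix.one_apply_eq, mul_one]
      congr 1
      ext ω
      simp only [Set.mem_inter_iff, Set.mem_ofPred_eq, nonpos_iff_eq_zero, forall_eq,
        Nat.cast_zero, zero_mul, add_zero]
      constructor
      · rintro ⟨⟨h1, -⟩, -⟩; exact h1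
      · rintro ⟨h1, h2⟩; exact ⟨⟨⟨h1, h2⟩, by rwa [h2]⟩, h2⟩
    · rw [Matrix.one_apply_ne hz, mul_zero]
      convert measureReal_empty
      ext ω
      simp only [Set.mem_inter_iff, Set.mem_ofPred_eq, Nat.cast_zero, zero_mul, add_zero,
        Set.mem_empty_iff_false, iff_false]
      rintro ⟨⟨⟨-, h1⟩, -⟩, h2⟩
      exact hz (h1.symm.trans h2)
  | succ N ih =>
    set F : Set Ω := E ∩ {ω | X s ω = y} ∩ {ω | ∀ k ≤ N, X (s + k * h) ω ∉ G} with hF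
    have hFm : MeasurableSet[past X (s + N * h)] F := by
      refine MeasurableSet.inter (MeasurableSet.inter (past_mono le_self_add _ hE) ?_) ?_
      · exact measurableSet_past le_self_add {y}
      · simp only [Set.ofPred_forall]
        refine MeasurableSet.iInter fun k => MeasurableSet.iInter fun hk => ?_
        exact measurableSet_past (by gcongr) Gᶜ
    have hset : E ∩ {ω | X s ω = y} ∩ {ω | ∀ k ≤ N + 1, X (s + k * h) ω ∉ G} ∩
        {ω | X (s + (N + 1 : ℕ) * h) ω = z} =
        F ∩ {ω | X (s + N * h + h) ω = z ∧ z ∉ G} := by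
      have e : s + ((N + 1 : ℕ) : ℝ≥0) * h = s + N * h + h := by push_cast; ring
      ext ω
      simp only [hF, Set.mem_inter_iff, Set.mem_ofPred_eq, Nat.le_succ_iff, or_imp,
        forall_and, forall_eq, e]
      constructor
      · rintro ⟨⟨h1, h2, h3⟩, h4⟩; exact ⟨⟨h1, h2⟩, h4, h4 ▸ h3⟩
      · rintro ⟨⟨h1, h2⟩, h3, h4⟩; exact ⟨⟨h1, h2, h3 ▸ h4⟩, h3⟩
    rw [hset, pow_succ, Matrix.mul_apply]
    by_cases hz : z ∈ G
    · simp [gridKernel, hz]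
    · have e : ∀ w, gridKernel Q G h w z = semigroup Q h w z := fun w => by
        simp [gridKernel, hz]
      simp only [hz, not_false_eq_true, and_true, e]
      rw [hX.real_eq_sum x (s + N * h), Finset.mul_sum]
      refine Finset.sum_congr rfl fun w _ => ?_
      rw [← mul_assoc, ← ih w, ← hX.markov x (s + N * h) h w z F hFm]
      congr 1
      ext ω
      simp only [Set.mem_inter_iff, Set.mem_ofPred_eq]
      tauto

lemma tendsto_real_grid (x : 𝒳) (G : Set 𝒳) (s t : ℝ≥0) {C : Set Ω} (hC : MeasurableSet C) :
    Tendsto (fun n => (P x).real (C ∩ {ω | ∀ k ≤ 2 ^ n, X (s + gridPt t n k) ω ∉ G})) atTop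
      (𝓝 ((P x).real (C ∩ {ω | ∀ u ≤ t, X (s + u) ω ∉ G}))) := by
  have := hX.prob x
  rw [hX.noHit_eq_iInter_grid, Set.inter_iInter]
  refine (ENNReal.tendsto_toReal (measure_ne_top _ _)).comp
    (tendsto_measure_iInter_atTop (fun n => ?_) ?_ ⟨0, measure_ne_top _ _⟩)
  · exact (hC.inter (hX.past_le _ _ (measurableSet_grid_past X G s t n))).nullMeasurableSet
  · refine antitone_nat_of_succ_le fun n => Set.inter_subset_inter_right C ?_
    intro ω hω k hk
    rw [← gridPt_succ]
    exact hω (2 * k) (by rw [pow_succ]; omega)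

lemma tendsto_gridKernel_pow_mul (x : 𝒳) (G : Set 𝒳) {s : ℝ≥0} {y : 𝒳} (hy : y ∉ G) {E : Set Ω}
    (hE : MeasurableSet[past X s] E) (t : ℝ≥0) (z : 𝒳) :
    Tendsto (fun n : ℕ => (P x).real (E ∩ {ω | X s ω = y}) *
        (gridKernel Q G (t / 2 ^ n) ^ 2 ^ n) y z) atTop
      (𝓝 ((P x).real (E ∩ {ω | X s ω = y} ∩
        {ω | X (s + t) ω = z ∧ ∀ u ≤ t, X (s + u) ω ∉ G}))) := by
  have h1 := hX.tendsto_real_grid x G s t (C := E ∩ {ω | X s ω = y} ∩ {ω | X (s + t) ω = z})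
    (((hX.past_le _ _ hE).inter (hX.meas _ _)).inter (hX.meas _ _))
  have e : E ∩ {ω | X s ω = y} ∩ {ω | X (s + t) ω = z} ∩ {ω | ∀ u ≤ t, X (s + u) ω ∉ G} =
      E ∩ {ω | X s ω = y} ∩ {ω | X (s + t) ω = z ∧ ∀ u ≤ t, X (s + u) ω ∉ G} := by
    rw [Set.inter_assoc]; rfl
  rw [e] at h1
  refine h1.congr fun n => ?_
  rw [← hX.real_grid_eq x G hy hE, Set.inter_right_comm]
  have e2 : ((2 ^ n : ℕ) : ℝ≥0) * (t / 2 ^ n) = t := gridPt_pow t n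
  rw [e2]
  rfl

lemma ae_start (x : 𝒳) (E : Set Ω) : (P x).real (E ∩ {ω | X 0 ω = x}) = (P x).real E := by
  have := hX.prob x
  refine le_antisymm (measureReal_mono Set.inter_subset_left) ?_
  have h1 : (P x).real {ω | X 0 ω = x}ᶜ = 0 := by
    rw [probReal_compl_eq_one_sub (hX.meas 0 x), hX.start x, sub_self]
  have h2 : E ⊆ (E ∩ {ω | X 0 ω = x}) ∪ {ω | X 0 ω = x}ᶜ := fun ω hω => by
    by_cases h : X 0 ω = x
    · exact Or.inl ⟨hω, h⟩
    · exact Or.inr h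
  refine (measureReal_mono h2).trans ((measureReal_union_le _ _).trans ?_)
  rw [h1, add_zero]

lemma killed_apply (G : Set 𝒳) (t : ℝ≥0) (x y : 𝒳) : killed P X G t x y =
    (P x).real {ω | X t ω = y ∧ ∀ u ≤ t, X u ω ∉ G} := by
  simp only [killed, Matrix.of_apply]
  congr 1
  ext ω
  simp only [Set.mem_ofPred_eq, coe_lt_hit_iff (hX.rightCont ω)]

lemma killed_of_mem {G : Set 𝒳} {x : 𝒳} (hx : x ∈ G) (t : ℝ≥0) (y : 𝒳) :
    killed P X G t x y = 0 := by
  rw [hX.killed_apply, ← hX.ae_start]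
  convert measureReal_empty
  ext ω
  simp only [Set.mem_inter_iff, Set.mem_ofPred_eq, Set.mem_empty_iff_false, iff_false]
  rintro ⟨⟨-, h1⟩, h2⟩
  exact h1 0 zero_le (h2 ▸ hx)

/-- The matrix powers do not know `E`, `s` or the starting point of the path, so identifying their
limit in the simplest case identifies it in all; this yields `markov_killed`, and later the duality
under time reversal. -/
lemma tendsto_gridKernel_pow {G : Set 𝒳} {y : 𝒳} (hy : y ∉ G) (t : ℝ≥0) (z : 𝒳) :
    Tendsto (fun n : ℕ => (gridKernel Q G (t / 2 ^ n) ^ 2 ^ n) y z) atTop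
      (𝓝 (killed P X G t y z)) := by
  have h1 := hX.tendsto_gridKernel_pow_mul y G (s := 0) hy MeasurableSet.univ t z
  simp only [Set.univ_inter, zero_add, hX.start y, one_mul] at h1
  rwa [Set.inter_comm, hX.ae_start, ← hX.killed_apply] at h1

/-- The Markov property for the chain killed on `G`. -/
lemma markov_killed (x : 𝒳) (G : Set 𝒳) {s : ℝ≥0} {E : Set Ω} (hE : MeasurableSet[past X s] E)
    (t : ℝ≥0) (y z : 𝒳) :
    (P x).real (E ∩ {ω | X s ω = y} ∩ {ω | X (s + t) ω = z ∧ ∀ u ≤ t, X (s + u) ω ∉ G}) =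
      (P x).real (E ∩ {ω | X s ω = y}) * killed P X G t y z := by
  by_cases hy : y ∈ G
  · rw [hX.killed_of_mem hy, mul_zero]
    convert measureReal_empty
    ext ω
    simp only [Set.mem_inter_iff, Set.mem_ofPred_eq, Set.mem_empty_iff_false, iff_false]
    rintro ⟨⟨-, h1⟩, -, h2⟩
    exact h2 0 zero_le (by rw [add_zero, h1]; exact hy)
  · exact tendsto_nhds_unique (hX.tendsto_gridKernel_pow_mul x G hy hE t z)
      ((hX.tendsto_gridKernel_pow hy t z).const_mul _)

lemma mass_killed (G : Set 𝒳) (t : ℝ≥0) (x : 𝒳) :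
    mass (killed P X G) t x = (P x).real {ω | (t : ℝ≥0∞) < hit X G ω} := by
  rw [hX.real_eq_sum x t, mass]
  refine Finset.sum_congr rfl fun y _ => ?_
  rw [killed, Matrix.of_apply, Set.inter_comm]
  rfl

lemma killed_add (G : Set 𝒳) (s t : ℝ≥0) :
    killed P X G (s + t) = killed P X G s * killed P X G t := by
  ext x z
  rw [Matrix.mul_apply, hX.killed_apply, hX.real_eq_sum x s]
  refine Finset.sum_congr rfl fun y _ => ?_
  have h1 := hX.markov_killed x G (hX.measurableSet_noHit_past G s) t y z
  have h2 : {ω | ∀ u ≤ s, X u ω ∉ G} ∩ {ω | X s ω = y} =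
      {ω | X s ω = y ∧ ∀ u ≤ s, X u ω ∉ G} := by
    ext ω; simp only [Set.mem_inter_iff, Set.mem_ofPred_eq]; tauto
  rw [h2, ← hX.killed_apply] at h1
  rw [← h1]
  congr 1
  ext ω
  simp only [Set.mem_inter_iff, Set.mem_ofPred_eq, noHit_add_iff X G s t ω]
  tauto

end IsMarkovChain
end HittingTime
end

noncomputable section

/-! ### The Markov property at the first visit to a set. -/

namespace HittingTime

variable {𝒳 Ω : Type*}

/-- The paths which visit `B` before time `R` without visiting `G` before. -/
def visits (X : ℝ≥0 → Ω → 𝒳) (B G : Set 𝒳) (R : ℝ≥0) : Set Ω :=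
  {ω | ∃ u ≤ R, X u ω ∈ B ∧ ∀ v ≤ u, X v ω ∉ G}

/-- The paths whose first visit to `B` on the grid is at the `k`-th point, before visiting `G`. -/
def firstGridVisit (X : ℝ≥0 → Ω → 𝒳) (B G : Set 𝒳) (R : ℝ≥0) (n k : ℕ) : Set Ω :=
  {ω | (∀ v ≤ gridPt R n k, X v ω ∉ G) ∧ X (gridPt R n k) ω ∈ B ∧
    ∀ j < k, X (gridPt R n j) ω ∉ B}

/-- The paths which visit `B` at a point of the grid before visiting `G`. -/
def gridVisits (X : ℝ≥0 → Ω → 𝒳) (B G : Set 𝒳) (R : ℝ≥0) (n : ℕ) : Set Ω :=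
  {ω | ∃ k ≤ 2 ^ n, X (gridPt R n k) ω ∈ B ∧ ∀ v ≤ gridPt R n k, X v ω ∉ G}

lemma gridVisits_eq (X : ℝ≥0 → Ω → 𝒳) (B G : Set 𝒳) (R : ℝ≥0) (n : ℕ) :
    gridVisits X B G R n = ⋃ k ∈ Finset.range (2 ^ n + 1), firstGridVisit X B G R n k := by
  classical
  ext ω
  simp only [gridVisits, firstGridVisit, Set.mem_ofPred_eq, Set.mem_iUnion, Finset.mem_range,
    exists_prop, Order.lt_add_one_iff]
  constructor
  · rintro ⟨k, hk, hB, hG⟩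
    have hex : ∃ j, X (gridPt R n j) ω ∈ B := ⟨k, hB⟩
    have hle : Nat.find hex ≤ k := Nat.find_min' hex hB
    exact ⟨Nat.find hex, hle.trans hk, fun v hv => hG v (hv.trans (gridPt_mono R n hle)),
      Nat.find_spec hex, fun j hj => Nat.find_min hex hj⟩
  · rintro ⟨k, hk, hG, hB, -⟩
    exact ⟨k, hk, hB, hG⟩

lemma pairwise_disjoint_firstGridVisit (X : ℝ≥0 → Ω → 𝒳) (B G : Set 𝒳) (R : ℝ≥0) (n : ℕ) :
    Pairwise fun i j => Disjoint (firstGridVisit X B G R n i) (firstGridVisit X B G R n j) := by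
  intro i j hij
  rw [Set.disjoint_left]
  rintro ω ⟨-, hi, hi'⟩ ⟨-, hj, hj'⟩
  rcases lt_or_gt_of_ne hij with h | h
  · exact hj' i h hi
  · exact hi' j h hj

lemma visits_eq_iUnion {X : ℝ≥0 → Ω → 𝒳} (hrc : ∀ ω t, ∀ᶠ s in 𝓝[≥] t, X s ω = X t ω)
    (B G : Set 𝒳) (R : ℝ≥0) : visits X B G R = ⋃ n, gridVisits X B G R n := by
  ext ω
  simp only [visits, gridVisits, Set.mem_ofPred_eq, Set.mem_iUnion]
  constructor
  · rintro ⟨u, hu, h⟩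
    refine exists_gridPt_of_exists (p := fun u => X u ω ∈ B ∧ ∀ v ≤ u, X v ω ∉ G) ?_ hu h |>.imp
      fun n ⟨k, hk⟩ => ⟨k, hk⟩
    -- The condition holds on a right neighbourhood of each time where it holds, so some dyadic grid
    -- detects it.
    rintro u ⟨hB, hG⟩
    obtain ⟨w, hw, hsub⟩ := (mem_nhdsGE_iff_exists_Ico_subset' (lt_add_one u)).mp (hrc ω u)
    refine (mem_nhdsGE_iff_exists_Ico_subset' (lt_add_one u)).mpr ⟨w, hw, fun s hs => ?_⟩
    have hs' : X s ω = X u ω := hsub hs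
    refine ⟨by rw [hs']; exact hB, fun v hv => ?_⟩
    rcases le_total v u with hvu | hvu
    · exact hG v hvu
    · have hv' : X v ω = X u ω := hsub ⟨hvu, hv.trans_lt hs.2⟩
      rw [hv']
      exact hG u le_rfl
  · rintro ⟨n, k, hk, h⟩
    exact ⟨_, gridPt_le hk, h⟩

lemma monotone_gridVisits (X : ℝ≥0 → Ω → 𝒳) (B G : Set 𝒳) (R : ℝ≥0) :
    Monotone (gridVisits X B G R) := by
  refine monotone_nat_of_le_succ fun n => ?_
  rintro ω ⟨k, hk, h⟩
  exact ⟨2 * k, by rw [pow_succ]; omega, by rwa [gridPt_succ]⟩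

variable [MeasurableSpace Ω] [Fintype 𝒳] [DecidableEq 𝒳]

namespace IsMarkovChain

variable {Q : Matrix 𝒳 𝒳 ℝ} {P : 𝒳 → Measure Ω} {X : ℝ≥0 → Ω → 𝒳}
  (hX : IsMarkovChain Q P X)
include hX

lemma markov_killed_on (x : 𝒳) (G F : Set 𝒳) {s : ℝ≥0} {E : Set Ω}
    (hE : MeasurableSet[past X s] E) (t : ℝ≥0) :
    (P x).real (E ∩ {ω | X (s + t) ω ∈ F ∧ ∀ u ≤ t, X (s + u) ω ∉ G}) =
      ∑ y, (P x).real (E ∩ {ω | X s ω = y}) * massOn (killed P X G) F t y := by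
  rw [hX.real_eq_sum x s]
  refine Finset.sum_congr rfl fun y _ => ?_
  rw [hX.real_eq_sum x (s + t), massOn, Finset.mul_sum]
  refine Finset.sum_congr rfl fun z _ => ?_
  by_cases hz : z ∈ F
  · rw [Set.indicator_of_mem hz, ← hX.markov_killed x G hE]
    congr 1
    ext ω
    simp only [Set.mem_inter_iff, Set.mem_ofPred_eq]
    constructor
    · rintro ⟨⟨⟨h1, -, h2⟩, h3⟩, h4⟩; exact ⟨⟨h1, h3⟩, h4, h2⟩
    · rintro ⟨⟨h1, h3⟩, h4, h2⟩; exact ⟨⟨⟨h1, h4 ▸ hz, h2⟩, h3⟩, h4⟩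
  · rw [Set.indicator_of_notMem hz, mul_zero]
    convert measureReal_empty
    ext ω
    simp only [Set.mem_inter_iff, Set.mem_ofPred_eq, Set.mem_empty_iff_false, iff_false]
    rintro ⟨⟨⟨-, h1, -⟩, -⟩, h2⟩
    exact hz (h2 ▸ h1)

lemma measurableSet_firstGridVisit (B G : Set 𝒳) (R : ℝ≥0) (n k : ℕ) :
    MeasurableSet[past X (gridPt R n k)] (firstGridVisit X B G R n k) := by
  refine MeasurableSet.inter (hX.measurableSet_noHit_past G _)
    (MeasurableSet.inter (measurableSet_past le_rfl B) ?_)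
  change MeasurableSet[past X (gridPt R n k)] {ω | ∀ j < k, X (gridPt R n j) ω ∉ B}
  simp only [Set.ofPred_forall]
  exact MeasurableSet.iInter fun j => MeasurableSet.iInter fun hj =>
    measurableSet_past (gridPt_mono R n hj.le) Bᶜ

lemma measurableSet_survive (G : Set 𝒳) (t : ℝ≥0) : MeasurableSet {ω | ∀ u ≤ t, X u ω ∉ G} :=
  hX.past_le _ _ (hX.measurableSet_noHit_past G t)

/-- The first grid visit takes finitely many values, so only the Markov property at fixed times is
needed; the bounds must be uniform over the time `s + v` which is left. -/
lemma real_firstGridVisit_bounds (x : 𝒳) (B G F : Set 𝒳) (s R : ℝ≥0) {L U : ℝ}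
    (hL : ∀ u ≤ R, ∀ b ∈ B, L ≤ massOn (killed P X G) F (s + u) b)
    (hU : ∀ u ≤ R, ∀ b ∈ B, massOn (killed P X G) F (s + u) b ≤ U) {n k : ℕ} (hk : k ≤ 2 ^ n) :
    (P x).real (firstGridVisit X B G R n k) * L ≤ (P x).real (firstGridVisit X B G R n k ∩
        {ω | X (s + R) ω ∈ F ∧ ∀ u ≤ s + R, X u ω ∉ G}) ∧
    (P x).real (firstGridVisit X B G R n k ∩
        {ω | X (s + R) ω ∈ F ∧ ∀ u ≤ s + R, X u ω ∉ G}) ≤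
      (P x).real (firstGridVisit X B G R n k) * U := by
  obtain ⟨v, hv⟩ := exists_add_of_le (gridPt_le (T := R) hk)
  have hvR : v ≤ R := by rw [hv]; exact le_add_self
  have hT : s + R = gridPt R n k + (s + v) := by
    calc s + R = s + (gridPt R n k + v) := by rw [← hv]
      _ = _ := by ring
  have hset : firstGridVisit X B G R n k ∩ {ω | X (s + R) ω ∈ F ∧ ∀ u ≤ s + R, X u ω ∉ G} =
      firstGridVisit X B G R n k ∩ {ω | X (gridPt R n k + (s + v)) ω ∈ F ∧
        ∀ u ≤ s + v, X (gridPt R n k + u) ω ∉ G} := by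
    ext ω
    simp only [Set.mem_inter_iff, Set.mem_ofPred_eq, hT, noHit_add_iff X G (gridPt R n k) (s + v)]
    constructor
    · rintro ⟨h1, h2, -, h3⟩; exact ⟨h1, h2, h3⟩
    · rintro ⟨h1, h2, h3⟩; exact ⟨h1, h2, h1.1, h3⟩
  rw [hset, hX.markov_killed_on x G F (hX.measurableSet_firstGridVisit B G R n k),
    hX.real_eq_sum x (gridPt R n k) (firstGridVisit X B G R n k), Finset.sum_mul, Finset.sum_mul]
  have hempty : ∀ y ∉ B,
      (P x).real (firstGridVisit X B G R n k ∩ {ω | X (gridPt R n k) ω = y}) = 0 := by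
    intro y hy
    convert measureReal_empty
    ext ω
    simp only [Set.mem_inter_iff, Set.mem_ofPred_eq, Set.mem_empty_iff_false, iff_false]
    rintro ⟨h1, h2⟩
    exact hy (h2 ▸ h1.2.1)
  constructor
  · refine Finset.sum_le_sum fun y _ => ?_
    by_cases hy : y ∈ B
    · exact mul_le_mul_of_nonneg_left (hL v hvR y hy) measureReal_nonneg
    · rw [hempty y hy, zero_mul, zero_mul]
  · refine Finset.sum_le_sum fun y _ => ?_
    by_cases hy : y ∈ B
    · exact mul_le_mul_of_nonneg_left (hU v hvR y hy) measureReal_nonneg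
    · rw [hempty y hy, zero_mul, zero_mul]

lemma tendsto_real_gridVisits (x : 𝒳) (B G : Set 𝒳) (R : ℝ≥0) (W : Set Ω) :
    Tendsto (fun n => (P x).real (gridVisits X B G R n ∩ W)) atTop
      (𝓝 ((P x).real (visits X B G R ∩ W))) := by
  have := hX.prob x
  rw [visits_eq_iUnion hX.rightCont, Set.iUnion_inter]
  exact (ENNReal.tendsto_toReal (measure_ne_top _ _)).comp (tendsto_measure_iUnion_atTop
    fun m n hmn => Set.inter_subset_inter_left W (monotone_gridVisits X B G R hmn))

lemma real_gridVisits_inter (x : 𝒳) (B G : Set 𝒳) (R : ℝ≥0) (n : ℕ) {W : Set Ω}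
    (hW : MeasurableSet W) : (P x).real (gridVisits X B G R n ∩ W) =
      ∑ k ∈ Finset.range (2 ^ n + 1), (P x).real (firstGridVisit X B G R n k ∩ W) := by
  have := hX.prob x
  rw [gridVisits_eq, Set.iUnion₂_inter]
  refine measureReal_biUnion_finset (fun i _ j _ hij => ?_) fun k _ =>
    (hX.past_le _ _ (hX.measurableSet_firstGridVisit B G R n k)).inter hW
  exact (pairwise_disjoint_firstGridVisit X B G R n hij).mono Set.inter_subset_left
    Set.inter_subset_left

/-- The Markov property at the first visit to `B`. -/
lemma real_visits_bounds (x : 𝒳) (B G F : Set 𝒳) (s R : ℝ≥0) {L U : ℝ}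
    (hL : ∀ u ≤ R, ∀ b ∈ B, L ≤ massOn (killed P X G) F (s + u) b)
    (hU : ∀ u ≤ R, ∀ b ∈ B, massOn (killed P X G) F (s + u) b ≤ U) :
    (P x).real (visits X B G R) * L ≤ (P x).real (visits X B G R ∩
        {ω | X (s + R) ω ∈ F ∧ ∀ u ≤ s + R, X u ω ∉ G}) ∧
    (P x).real (visits X B G R ∩ {ω | X (s + R) ω ∈ F ∧ ∀ u ≤ s + R, X u ω ∉ G}) ≤
      (P x).real (visits X B G R) * U := by
  set W := {ω | X (s + R) ω ∈ F ∧ ∀ u ≤ s + R, X u ω ∉ G}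
  have hW : MeasurableSet W :=
    (hX.measurableSet_mem (s + R) F).inter (hX.measurableSet_survive G (s + R))
  have h1 := hX.tendsto_real_gridVisits x B G R W
  have h2 := hX.tendsto_real_gridVisits x B G R Set.univ
  simp only [Set.inter_univ] at h2
  have h3 : ∀ n, (P x).real (gridVisits X B G R n) =
      ∑ k ∈ Finset.range (2 ^ n + 1), (P x).real (firstGridVisit X B G R n k) := fun n => by
    simpa using hX.real_gridVisits_inter x B G R n MeasurableSet.univ
  constructor
  · refine le_of_tendsto_of_tendsto' (h2.mul_const L) h1 fun n => ?_
    rw [h3, hX.real_gridVisits_inter x B G R n hW, Finset.sum_mul]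
    exact Finset.sum_le_sum fun k hk => (hX.real_firstGridVisit_bounds x B G F s R hL hU
      (Nat.lt_succ_iff.mp (Finset.mem_range.mp hk))).1
  · refine le_of_tendsto_of_tendsto' h1 (h2.mul_const U) fun n => ?_
    rw [h3, hX.real_gridVisits_inter x B G R n hW, Finset.sum_mul]
    exact Finset.sum_le_sum fun k hk => (hX.real_firstGridVisit_bounds x B G F s R hL hU
      (Nat.lt_succ_iff.mp (Finset.mem_range.mp hk))).2

end IsMarkovChain

end HittingTime

end

noncomputable section

/-! ### Invariant law, time reversal and short-time behaviour of the rates. -/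

namespace HittingTime

variable {𝒳 Ω : Type*} [Fintype 𝒳] [DecidableEq 𝒳]

section Generator

/-- At a zero of π the invariance equation is a vanishing sum of nonnegative terms, so zeros
propagate to all predecessors. -/
lemma IsInvariant.pos {Q : Matrix 𝒳 𝒳 ℝ} {π : 𝒳 → ℝ} (hπ : IsInvariant Q π)
    (hQ : IsRateMatrix Q) (hirr : IsIrreducibleRate Q) (x : 𝒳) : 0 < π x := by
  by_contra hx
  have hx0 : π x = 0 := le_antisymm (not_lt.mp hx) (hπ.nonneg x)
  have step : ∀ a b, 0 < Q a b → π b = 0 → π a = 0 := by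
    intro a b hab hb
    have h1 := hπ.invariant b
    have h2 : ∀ c ∈ Finset.univ, 0 ≤ π c * Q c b := fun c _ => by
      by_cases hc : c = b
      · rw [hc, hb, zero_mul]
      · exact mul_nonneg (hπ.nonneg c) (hQ.nonneg c b hc)
    have h3 := (Finset.sum_eq_zero_iff_of_nonneg h2).mp h1 a (Finset.mem_univ a)
    exact (mul_eq_zero.mp h3).resolve_right hab.ne'
  have hall : ∀ y, π y = 0 := fun y => by
    have h := hirr y x
    induction h using Relation.ReflTransGen.head_induction_on with
    | refl => exact hx0
    | head hab _ ih => exact step _ _ hab ih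
  have := hπ.sum_one
  simp [hall] at this

/-- Conjugation by `diagonal π` turns the reversed rates into the transpose of `Q`, and the
exponential respects conjugation and transposition. -/
lemma semigroup_reversed {Q : Matrix 𝒳 𝒳 ℝ} {π : 𝒳 → ℝ} (hπ : ∀ x, 0 < π x) (t : ℝ≥0)
    (x y : 𝒳) : π x * semigroup Q t x y = π y * semigroup (reversedRates Q π) t y x := by
  set D : Matrix 𝒳 𝒳 ℝ := Matrix.diagonal π with hD
  have hDu : IsUnit D := by
    rw [Matrix.isUnit_iff_isUnit_det, Matrix.det_diagonal, isUnit_iff_ne_zero]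
    exact Finset.prod_ne_zero_iff.mpr fun x _ => (hπ x).ne'
  have h1 : D * reversedRates Q π = Q.transpose * D := by
    ext a b
    rw [Matrix.diagonal_mul, Matrix.mul_diagonal, reversedRates, Matrix.of_apply,
      Matrix.transpose_apply]
    have := (hπ a).ne'
    field_simp
  have h2 : D * ((t : ℝ) • reversedRates Q π) * D⁻¹ = ((t : ℝ) • Q).transpose := by
    rw [Matrix.mul_smul, h1, Matrix.transpose_smul, Matrix.smul_mul, Matrix.mul_assoc,
      Matrix.mul_nonsing_inv _ ((Matrix.isUnit_iff_isUnit_det D).mp hDu), Matrix.mul_one]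
  have h3 : D * semigroup (reversedRates Q π) t = (semigroup Q t).transpose * D := by
    have h4 := Matrix.exp_conj D ((t : ℝ) • reversedRates Q π) hDu
    rw [h2, Matrix.exp_transpose] at h4
    rw [semigroup, semigroup, h4, Matrix.mul_assoc,
      Matrix.nonsing_inv_mul _ ((Matrix.isUnit_iff_isUnit_det D).mp hDu), Matrix.mul_one]
  have h5 := congrFun (congrFun h3 y) x
  rw [Matrix.diagonal_mul, Matrix.mul_diagonal, Matrix.transpose_apply] at h5
  rw [h5, mul_comm]

lemma gridKernel_pow_eq_zero (Q : Matrix 𝒳 𝒳 ℝ) {G : Set 𝒳} (h : ℝ≥0) (N : ℕ) {x w : 𝒳}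
    (hx : x ∉ G) (hw : w ∈ G) : (gridKernel Q G h ^ N) x w = 0 := by
  cases N with
  | zero => rw [pow_zero, Matrix.one_apply_ne (ne_of_mem_of_not_mem hw hx).symm]
  | succ N =>
    rw [pow_succ, Matrix.mul_apply]
    exact Finset.sum_eq_zero fun z _ => by simp [gridKernel, hw]

lemma gridKernel_pow_reversed {Q : Matrix 𝒳 𝒳 ℝ} {π : 𝒳 → ℝ} (hπ : ∀ x, 0 < π x) {G : Set 𝒳}
    (h : ℝ≥0) (N : ℕ) {x y : 𝒳} (hx : x ∉ G) (hy : y ∉ G) :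
    π x * (gridKernel Q G h ^ N) x y = π y * (gridKernel (reversedRates Q π) G h ^ N) y x := by
  induction N generalizing y with
  | zero =>
    by_cases hxy : x = y
    · subst hxy; rfl
    · rw [pow_zero, pow_zero, Matrix.one_apply_ne hxy, Matrix.one_apply_ne (Ne.symm hxy), mul_zero,
        mul_zero]
  | succ N ih =>
    rw [pow_succ, pow_succ', Matrix.mul_apply, Matrix.mul_apply, Finset.mul_sum, Finset.mul_sum]
    refine Finset.sum_congr rfl fun w _ => ?_
    by_cases hw : w ∈ G
    · rw [gridKernel_pow_eq_zero Q h N hx hw]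
      simp [gridKernel, hw]
    · rw [← mul_assoc, ih hw]
      have e1 : gridKernel Q G h w y = semigroup Q h w y := by simp [gridKernel, hy]
      have e2 : gridKernel (reversedRates Q π) G h y w = semigroup (reversedRates Q π) h y w := by
        simp [gridKernel, hw]
      rw [e1, e2, ← mul_assoc, ← semigroup_reversed hπ]
      ring

attribute [local instance] Matrix.linftyOpNormedRing Matrix.linftyOpNormedAlgebra in
lemma hasDerivAt_exp_apply (Q : Matrix 𝒳 𝒳 ℝ) (x y : 𝒳) :
    HasDerivAt (fun t : ℝ => NormedSpace.exp (t • Q) x y) (Q x y) 0 := by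
  have h1 := hasDerivAt_exp_smul_const (𝕂 := ℝ) Q 0
  rw [zero_smul, NormedSpace.exp_zero, one_mul] at h1
  exact ((Matrix.entryLinearMap ℝ ℝ x y).toContinuousLinearMap.hasFDerivAt.comp_hasDerivAt
    (0 : ℝ) h1)

lemma eventually_semigroup_gt (Q : Matrix 𝒳 𝒳 ℝ) (x y : 𝒳) {c : ℝ} (hc : c < Q x y) :
    ∀ᶠ t : ℝ≥0 in 𝓝 0, (1 : Matrix 𝒳 𝒳 ℝ) x y + t * c ≤ semigroup Q t x y := by
  have h1 := hasDerivAt_exp_apply Q x y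
  rw [hasDerivAt_iff_tendsto_slope_zero] at h1
  have h2 := h1.eventually (lt_mem_nhds hc)
  rw [eventually_nhdsWithin_iff] at h2
  have h3 : Tendsto (fun t : ℝ≥0 => (t : ℝ)) (𝓝 0) (𝓝 0) := by
    simpa using (NNReal.continuous_coe.tendsto 0)
  filter_upwards [h3.eventually h2] with t ht
  rcases eq_or_ne t 0 with rfl | h0
  · simp [semigroup]
  · have h4 := ht (by simpa using h0)
    have ht0 : (0 : ℝ) < t := by exact_mod_cast pos_iff_ne_zero.mpr h0
    simp only [zero_add, zero_smul, NormedSpace.exp_zero, smul_eq_mul] at h4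
    rw [inv_mul_eq_div, lt_div_iff₀ ht0] at h4
    rw [semigroup]
    linarith

end Generator

end HittingTime

end

noncomputable section

/-! ### Positivity, absence of atoms and duality for the killed chain. -/

namespace HittingTime

variable {𝒳 Ω Ω' : Type*} [MeasurableSpace Ω] [MeasurableSpace Ω'] [Fintype 𝒳]

lemma real_fromLaw {P : 𝒳 → Measure Ω} (hP : ∀ x, IsProbabilityMeasure (P x)) {ν : 𝒳 → ℝ}
    (hν : ∀ x, 0 ≤ ν x) (E : Set Ω) : (fromLaw P ν).real E = ∑ x, ν x * (P x).real E := by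
  rw [fromLaw, Measure.real, Measure.finsetSum_apply, ENNReal.toReal_sum]
  · refine Finset.sum_congr rfl fun x _ => ?_
    rw [Measure.smul_apply, smul_eq_mul, ENNReal.toReal_mul, ENNReal.toReal_ofReal (hν x)]
    rfl
  · intro x _
    exact (ENNReal.mul_lt_top ENNReal.ofReal_lt_top (measure_lt_top _ _)).ne

variable [DecidableEq 𝒳]

/-- Counts the paths that wait at `a`, jump once and wait at `b`: there are `N` possible jump times.
-/
lemma pow_apply_ge {K : Matrix 𝒳 𝒳 ℝ} (hK : ∀ x y, 0 ≤ K x y) {a b : 𝒳} (hab : a ≠ b) {e δ : ℝ}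
    (he0 : 0 ≤ e) (he1 : e ≤ 1) (hδ : 0 ≤ δ) (ha : 1 - e ≤ K a a) (hb : 1 - e ≤ K b b)
    (hd : δ ≤ K a b) (N : ℕ) :
    (∀ x y, 0 ≤ (K ^ N) x y) ∧ (1 - e) ^ N ≤ (K ^ N) a a ∧ N * δ * (1 - e) ^ N ≤ (K ^ N) a b := by
  induction N with
  | zero =>
    refine ⟨fun x y => ?_, by simp, by simp [hab]⟩
    rw [pow_zero, Matrix.one_apply]
    split_ifs <;> norm_num
  | succ N ih =>
    obtain ⟨ih0, iha, ihb⟩ := ih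
    have h1e : 0 ≤ 1 - e := by linarith
    have hp : 0 ≤ (1 - e) ^ N := pow_nonneg h1e N
    refine ⟨fun x y => ?_, ?_, ?_⟩
    · rw [pow_succ, Matrix.mul_apply]
      exact Finset.sum_nonneg fun z _ => mul_nonneg (ih0 x z) (hK z y)
    · rw [pow_succ, pow_succ, Matrix.mul_apply]
      calc (1 - e) ^ N * (1 - e) ≤ (K ^ N) a a * K a a := by gcongr; exact ih0 a a
        _ ≤ ∑ z, (K ^ N) a z * K z a := Finset.single_le_sum
            (f := fun z => (K ^ N) a z * K z a) (fun z _ => mul_nonneg (ih0 a z) (hK z a))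
            (Finset.mem_univ a)
    · rw [pow_succ K, Matrix.mul_apply]
      have hpair : (K ^ N) a a * K a b + (K ^ N) a b * K b b ≤ ∑ z, (K ^ N) a z * K z b := by
        rw [← Finset.sum_pair (f := fun z => (K ^ N) a z * K z b) hab]
        exact Finset.sum_le_sum_of_subset_of_nonneg (Finset.subset_univ _)
          fun z _ _ => mul_nonneg (ih0 a z) (hK z b)
      refine le_trans ?_ hpair
      have h1 : (1 - e) ^ (N + 1) * δ ≤ (K ^ N) a a * K a b := by
        calc (1 - e) ^ (N + 1) * δ ≤ (1 - e) ^ N * δ :=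
              mul_le_mul_of_nonneg_right (pow_le_pow_of_le_one h1e (by linarith) (Nat.le_succ N)) hδ
          _ ≤ (K ^ N) a a * K a b := by gcongr; exact ih0 a a
      have h2 : N * δ * (1 - e) ^ N * (1 - e) ≤ (K ^ N) a b * K b b := by
        gcongr; exact ih0 a b
      have h3 : ((N + 1 : ℕ) : ℝ) * δ * (1 - e) ^ (N + 1) =
          (1 - e) ^ (N + 1) * δ + N * δ * (1 - e) ^ N * (1 - e) := by push_cast; ring
      rw [h3]
      exact add_le_add h1 h2

namespace IsMarkovChain

variable {Q : Matrix 𝒳 𝒳 ℝ} {P : 𝒳 → Measure Ω} {X : ℝ≥0 → Ω → 𝒳}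

section

variable (hX : IsMarkovChain Q P X)
include hX

lemma semigroup_eq (t : ℝ≥0) (x y : 𝒳) : semigroup Q t x y = (P x).real {ω | X t ω = y} := by
  have h1 := hX.markov x 0 t x y Set.univ MeasurableSet.univ
  rw [Set.univ_inter, Set.univ_inter, hX.start, one_mul, zero_add] at h1
  rw [← h1, ← hX.ae_start x {ω | X t ω = y}]
  congr 1
  ext ω
  exact and_comm

lemma evol_eq (x : 𝒳) (t : ℝ≥0) (y : 𝒳) : evol P X x t y = killed P X ∅ t x y := by
  rw [hX.killed_apply, evol]
  simp

lemma killed_zero_self {G : Set 𝒳} {x : 𝒳} (hx : x ∉ G) : killed P X G 0 x x = 1 := by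
  rw [hX.killed_apply, ← hX.start x]
  congr 1
  ext ω
  simp only [Set.mem_ofPred_eq, nonpos_iff_eq_zero, forall_eq, and_iff_left_iff_imp]
  exact fun h => h ▸ hx

lemma killed_apply_mem {G : Set 𝒳} {y : 𝒳} (hy : y ∈ G) (t : ℝ≥0) (x : 𝒳) :
    killed P X G t x y = 0 := by
  rw [hX.killed_apply]
  convert measureReal_empty
  ext ω
  simp only [Set.mem_ofPred_eq, Set.mem_empty_iff_false, iff_false]
  rintro ⟨h1, h2⟩
  exact h2 t le_rfl (h1 ▸ hy)

lemma mass_killed_eq (G : Set 𝒳) (t : ℝ≥0) (x : 𝒳) :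
    mass (killed P X G) t x = (P x).real {ω | ∀ u ≤ t, X u ω ∉ G} := by
  rw [hX.mass_killed]
  congr 1
  ext ω
  exact coe_lt_hit_iff (hX.rightCont ω) G t

lemma mass_killed_le_one (G : Set 𝒳) (t : ℝ≥0) (x : 𝒳) : mass (killed P X G) t x ≤ 1 := by
  have := hX.prob x
  rw [hX.mass_killed]
  exact measureReal_le_one

lemma killed_mono {G G' : Set 𝒳} (hG : G ⊆ G') (t : ℝ≥0) (x y : 𝒳) :
    killed P X G' t x y ≤ killed P X G t x y := by
  have := hX.prob x
  rw [hX.killed_apply, hX.killed_apply]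
  exact measureReal_mono fun ω h => ⟨h.1, fun u hu hm => h.2 u hu (hG hm)⟩

lemma mass_killed_empty (t : ℝ≥0) (x : 𝒳) : mass (killed P X ∅) t x = 1 := by
  have := hX.prob x
  rw [hX.mass_killed_eq]
  simp

lemma exists_killed_pos_of_rate {G : Set 𝒳} {a b : 𝒳} (ha : a ∉ G) (hb : b ∉ G)
    (hab : 0 < Q a b) : ∃ t, 0 < killed P X G t a b := by
  rcases eq_or_ne a b with rfl | hne
  · exact ⟨0, by rw [hX.killed_zero_self ha]; norm_num⟩
  set C : ℝ := |Q a a| + |Q b b| + 1 with hC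
  have hC1 : 1 ≤ C := by rw [hC]; linarith [abs_nonneg (Q a a), abs_nonneg (Q b b)]
  have hCa : -C < Q a a := by linarith [neg_abs_le (Q a a), abs_nonneg (Q b b)]
  have hCb : -C < Q b b := by linarith [neg_abs_le (Q b b), abs_nonneg (Q a a)]
  -- With `t * C = 1 / 2`, Bernoulli's inequality keeps the probability of the waiting steps above
  -- 1/2 for every mesh, so the lower bound passes to the limit.
  set t : ℝ≥0 := ⟨1 / (2 * C), by positivity⟩ with ht
  have htC : (t : ℝ) * C = 1 / 2 := by
    change 1 / (2 * C) * C = 1 / 2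
    field_simp
  have ht0 : (0 : ℝ) < t := by
    change (0 : ℝ) < 1 / (2 * C)
    positivity
  refine ⟨t, lt_of_lt_of_le (show (0 : ℝ) < t * (Q a b / 2) / 2 by positivity) ?_⟩
  refine ge_of_tendsto (hX.tendsto_gridKernel_pow ha t b) ?_
  have hlim : Tendsto (fun n : ℕ => t / 2 ^ n) atTop (𝓝 0) := by
    rw [← NNReal.tendsto_coe]
    push_cast
    have := (tendsto_pow_atTop_nhds_zero_of_lt_one (r := (1 / 2 : ℝ)) (by norm_num)
      (by norm_num)).const_mul (t : ℝ)
    simpa [div_eq_mul_inv] using this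
  filter_upwards [hlim.eventually (eventually_semigroup_gt Q a a hCa),
    hlim.eventually (eventually_semigroup_gt Q b b hCb),
    hlim.eventually (eventually_semigroup_gt Q a b (half_lt_self hab))] with n h1 h2 h3
  set s : ℝ≥0 := t / 2 ^ n with hs
  have hgrid : ∀ x y, y ∉ G → gridKernel Q G s x y = semigroup Q s x y := fun x y hy => by
    simp [gridKernel, hy]
  have hK : ∀ x y, 0 ≤ gridKernel Q G s x y := fun x y => by
    rw [gridKernel, Matrix.of_apply]
    exact Set.indicator_nonneg (fun z _ => by rw [hX.semigroup_eq]; exact measureReal_nonneg) y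
  have hsN : ((2 ^ n : ℕ) : ℝ) * s = t := by
    have : ((2 ^ n : ℕ) : ℝ≥0) * s = t := gridPt_pow t n
    exact_mod_cast this
  have hN1 : (1 : ℝ) ≤ ((2 ^ n : ℕ) : ℝ) := by exact_mod_cast Nat.one_le_two_pow
  have hs0 : (0 : ℝ) ≤ s := s.2
  have hsC : (s : ℝ) * C ≤ 1 := by nlinarith [mul_nonneg hs0 (by linarith : 0 ≤ C)]
  simp only [Matrix.one_apply_eq, Matrix.one_apply_ne hne] at h1 h2 h3
  have key := (pow_apply_ge hK hne (e := s * C) (δ := s * (Q a b / 2)) (by positivity) hsC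
    (by positivity) (by rw [hgrid a a ha]; linarith) (by rw [hgrid b b hb]; linarith)
    (by rw [hgrid a b hb]; linarith) (2 ^ n)).2.2
  have hbern := one_add_mul_le_pow (a := -((s : ℝ) * C)) (by linarith) (2 ^ n)
  have e1 : ((2 ^ n : ℕ) : ℝ) * -((s : ℝ) * C) = -(1 / 2) := by
    rw [← htC, ← hsN]; ring
  rw [e1, ← sub_eq_add_neg, ← sub_eq_add_neg] at hbern
  refine le_trans ?_ key
  have e2 : ((2 ^ n : ℕ) : ℝ) * (s * (Q a b / 2)) = t * (Q a b / 2) := by rw [← hsN]; ring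
  rw [e2, div_eq_mul_inv]
  gcongr
  linarith

/-- States which communicate inside `Gᶜ` are reached by the killed chain. -/
lemma exists_killed_pos {G : Set 𝒳} {x y : 𝒳} (hx : x ∉ G)
    (hxy : Relation.ReflTransGen (fun a b => 0 < Q a b ∧ b ∈ Gᶜ) x y) :
    ∃ t, 0 < killed P X G t x y := by
  have key : y ∉ G ∧ ∃ t, 0 < killed P X G t x y := by
    induction hxy with
    | refl => exact ⟨hx, 0, by rw [hX.killed_zero_self hx]; norm_num⟩
    | @tail b c _ hbc ih =>
      obtain ⟨hb, s, hs⟩ := ih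
      obtain ⟨t, ht⟩ := hX.exists_killed_pos_of_rate hb hbc.2 hbc.1
      refine ⟨hbc.2, s + t, ?_⟩
      rw [hX.killed_add, Matrix.mul_apply]
      exact lt_of_lt_of_le (mul_pos hs ht) (Finset.single_le_sum
        (f := fun z => killed P X G s x z * killed P X G t z c)
        (fun z _ => mul_nonneg (killed_nonneg ..) (killed_nonneg ..)) (Finset.mem_univ b))
  exact key.2

lemma mass_killed_anti (G : Set 𝒳) {s t : ℝ≥0} (hst : s ≤ t) (x : 𝒳) :
    mass (killed P X G) t x ≤ mass (killed P X G) s x := by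
  have := hX.prob x
  rw [hX.mass_killed_eq, hX.mass_killed_eq]
  exact measureReal_mono fun ω h u hu => h u (hu.trans hst)

lemma mass_killed_add (G : Set 𝒳) (s t : ℝ≥0) (x : 𝒳) :
    mass (killed P X G) (s + t) x = ∑ y, killed P X G s x y * mass (killed P X G) t y := by
  simp only [mass, hX.killed_add, Matrix.mul_apply, Finset.mul_sum]
  exact Finset.sum_comm

/-- The chain hits every nonempty set with positive probability, uniformly in the start. -/
lemma exists_mass_killed_lt_one (hirr : IsIrreducibleRate Q) {G : Set 𝒳} (hG : G.Nonempty) :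
    ∃ t, ∀ x, mass (killed P X G) t x < 1 := by
  obtain ⟨g, hg⟩ := hG
  have h1 : ∀ x, ∃ t, mass (killed P X G) t x < 1 := by
    intro x
    have := hX.prob x
    obtain ⟨t, ht⟩ := hX.exists_killed_pos (G := ∅) (x := x) (y := g) (Set.notMem_empty x)
      (Relation.ReflTransGen.mono (fun a b h => ⟨h, by simp⟩) x g (hirr x g))
    refine ⟨t, ?_⟩
    rw [← hX.evol_eq, evol] at ht
    rw [hX.mass_killed_eq]
    have h2 : {ω | ∀ u ≤ t, X u ω ∉ G} ⊆ {ω | X t ω = g}ᶜ := fun ω h e =>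
      h t le_rfl (by rw [show X t ω = g from e]; exact hg)
    have h3 := measureReal_mono (μ := P x) h2
    rw [probReal_compl_eq_one_sub (hX.meas t g)] at h3
    linarith
  choose t ht using h1
  refine ⟨∑ x, t x, fun x => lt_of_le_of_lt (hX.mass_killed_anti G ?_ x) (ht x)⟩
  exact Finset.single_le_sum (f := t) (fun _ _ => zero_le) (Finset.mem_univ x)

lemma exists_mass_killed_ge {G : Set 𝒳} {ε : ℝ} (hε : 0 < ε) :
    ∃ h > 0, ∀ y ∉ G, 1 - ε ≤ mass (killed P X G) h y := by
  have h1 : ∀ y, ∃ h > 0, y ∉ G → 1 - ε ≤ mass (killed P X G) h y := by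
    intro y
    by_cases hy : y ∈ G
    · exact ⟨1, one_pos, fun h => absurd hy h⟩
    have := hX.prob y
    set A : ℕ → Set Ω := fun n => {ω | ∀ u ≤ (1 / (n + 1) : ℝ≥0), X u ω ∉ G} with hA
    have hmono : Monotone A := fun m n hmn ω hω u hu => hω u (hu.trans (by gcongr))
    have hsub : {ω | X 0 ω = y} ⊆ ⋃ n, A n := by
      intro ω hω
      obtain ⟨v, hv, hs⟩ := (mem_nhdsGE_iff_exists_Ico_subset' one_pos).mp (hX.rightCont ω 0)
      obtain ⟨n, hn⟩ := exists_nat_one_div_lt (NNReal.coe_pos.mpr hv)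
      have hn' : (1 / (n + 1) : ℝ≥0) < v := by
        rw [← NNReal.coe_lt_coe]; push_cast; exact hn
      refine Set.mem_iUnion.mpr ⟨n, fun u hu => ?_⟩
      have : X u ω = X 0 ω := hs ⟨zero_le, hu.trans_lt hn'⟩
      rw [this, show X 0 ω = y from hω]
      exact hy
    have hone : (P y).real (⋃ n, A n) = 1 :=
      le_antisymm measureReal_le_one ((hX.start y).symm.le.trans (measureReal_mono hsub))
    have hlim : Tendsto (fun n => (P y).real (A n)) atTop (𝓝 ((P y).real (⋃ n, A n))) :=
      (ENNReal.tendsto_toReal (measure_ne_top _ _)).comp (tendsto_measure_iUnion_atTop hmono)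
    rw [hone] at hlim
    obtain ⟨n, hn⟩ := (hlim.eventually (lt_mem_nhds (sub_lt_self 1 hε))).exists
    refine ⟨1 / (n + 1), by positivity, fun _ => ?_⟩
    rw [hX.mass_killed_eq]
    exact hn.le
  choose h hpos hh using h1
  rcases isEmpty_or_nonempty 𝒳 with hemp | hne
  · exact ⟨1, one_pos, fun y => (hemp.false y).elim⟩
  obtain ⟨y₀, hy₀⟩ := Finite.exists_min h
  exact ⟨h y₀, hpos y₀, fun y hy => (hh y hy).trans (hX.mass_killed_anti G (hy₀ y) y)⟩

/-- The law of the hitting time has no atoms in `(0, ∞)`. -/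
lemma real_le_hit_eq {G : Set 𝒳} {s : ℝ≥0} (hs : 0 < s) (x : 𝒳) :
    (P x).real {ω | (s : ℝ≥0∞) ≤ hit X G ω} = mass (killed P X G) s x := by
  have := hX.prob x
  refine le_antisymm ?_ ?_
  swap
  · rw [hX.mass_killed]
    exact measureReal_mono fun ω h => show (s : ℝ≥0∞) ≤ hit X G ω from le_of_lt h
  refine le_of_forall_pos_le_add fun ε hε => ?_
  obtain ⟨h, hpos, hh⟩ := hX.exists_mass_killed_ge (G := G) hε
  have hm : 0 < min h s := lt_min hpos hs
  obtain ⟨v, hv⟩ := exists_add_of_le (min_le_right h s)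
  have hvs : v < s := by rw [hv]; exact lt_add_of_pos_left v hm
  -- An atom at `s` would require dying between `v` and `s`; by finiteness of the state space a
  -- short survival time works uniformly over the positions at `v`.
  have h1 : (P x).real {ω | (s : ℝ≥0∞) ≤ hit X G ω} ≤ mass (killed P X G) v x := by
    rw [hX.mass_killed]
    exact measureReal_mono fun ω h => lt_of_lt_of_le
      (show (v : ℝ≥0∞) < s by exact_mod_cast hvs) h
  have h2 : mass (killed P X G) v x - mass (killed P X G) s x ≤ ε := by
    conv_lhs => rw [hv, add_comm (min h s) v, hX.mass_killed_add]
    calc mass (killed P X G) v x - ∑ y, killed P X G v x y * mass (killed P X G) (min h s) y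
        = ∑ y, killed P X G v x y * (1 - mass (killed P X G) (min h s) y) := by
          rw [mass, ← Finset.sum_sub_distrib]
          exact Finset.sum_congr rfl fun y _ => by ring
      _ ≤ ∑ y, killed P X G v x y * ε := by
          refine Finset.sum_le_sum fun y _ => ?_
          by_cases hy : y ∈ G
          · rw [hX.killed_apply_mem hy, zero_mul, zero_mul]
          · refine mul_le_mul_of_nonneg_left ?_ (killed_nonneg ..)
            linarith [hh y hy, hX.mass_killed_anti G (min_le_left h s) y]
      _ ≤ ε := by
          rw [← Finset.sum_mul]
          exact mul_le_of_le_one_left hε.le (hX.mass_killed_le_one G v x)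
  linarith

end

lemma killed_reversed {P' : 𝒳 → Measure Ω'} {X' : ℝ≥0 → Ω' → 𝒳} {π : 𝒳 → ℝ}
    (hX : IsMarkovChain Q P X) (hX' : IsMarkovChain (reversedRates Q π) P' X')
    (hπ : ∀ x, 0 < π x) (G : Set 𝒳) (t : ℝ≥0) (x y : 𝒳) :
    π x * killed P X G t x y = π y * killed P' X' G t y x := by
  by_cases hx : x ∈ G
  · rw [hX.killed_of_mem hx, hX'.killed_apply_mem hx, mul_zero, mul_zero]
  by_cases hy : y ∈ G
  · rw [hX.killed_apply_mem hy, hX'.killed_of_mem hy, mul_zero, mul_zero]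
  refine tendsto_nhds_unique ((hX.tendsto_gridKernel_pow hx t y).const_mul (π x)) ?_
  refine ((hX'.tendsto_gridKernel_pow hy t x).const_mul (π y)).congr fun n => ?_
  exact (gridKernel_pow_reversed hπ _ _ hx hy).symm

end IsMarkovChain

end HittingTime

end

noncomputable section

/-! ### Restricted invariant law and first-visit decompositions. -/

namespace HittingTime

section Restricted

variable {𝒳 : Type*} [Fintype 𝒳] {π : 𝒳 → ℝ} {A : Set 𝒳}

lemma sum_restricted_mul {u : 𝒳 → ℝ} (hu : ∀ x ∉ A, u x = 0) :
    ∑ x, restricted π A x * u x = (∑ x, π x * u x) / ∑ z, A.indicator π z := by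
  rw [Finset.sum_div]
  refine Finset.sum_congr rfl fun x _ => ?_
  by_cases hx : x ∈ A
  · rw [restricted, Set.indicator_of_mem hx]; ring
  · rw [hu x hx]; ring

variable (hπ : ∀ x, 0 < π x) (hA : A.Nonempty)
include hπ hA

lemma sum_indicator_pos : 0 < ∑ z, A.indicator π z := by
  obtain ⟨a, ha⟩ := hA
  refine Finset.sum_pos' (fun z _ => Set.indicator_nonneg (fun _ _ => (hπ _).le) z)
    ⟨a, Finset.mem_univ a, ?_⟩
  rw [Set.indicator_of_mem ha]
  exact hπ a

lemma restricted_nonneg (x : 𝒳) : 0 ≤ restricted π A x :=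
  div_nonneg (Set.indicator_nonneg (fun _ _ => (hπ _).le) x) (sum_indicator_pos hπ hA).le

lemma sum_restricted : ∑ x, restricted π A x = 1 := by
  simp only [restricted]
  rw [← Finset.sum_div, div_self (sum_indicator_pos hπ hA).ne']

end Restricted

variable {𝒳 Ω Ω' : Type*} [MeasurableSpace Ω] [MeasurableSpace Ω'] [Fintype 𝒳] [DecidableEq 𝒳]

namespace IsMarkovChain

variable {Q : Matrix 𝒳 𝒳 ℝ} {P : 𝒳 → Measure Ω} {X : ℝ≥0 → Ω → 𝒳}

section

variable (hX : IsMarkovChain Q P X)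
include hX

lemma real_hit_le (K : Set 𝒳) (t : ℝ≥0) (x : 𝒳) :
    (P x).real {ω | hit X K ω ≤ (t : ℝ≥0∞)} = 1 - mass (killed P X K) t x := by
  have := hX.prob x
  rw [hX.mass_killed_eq, ← probReal_compl_eq_one_sub (hX.measurableSet_survive K t)]
  congr 1
  ext ω
  rw [Set.mem_compl_iff, Set.mem_ofPred_eq, Set.mem_ofPred_eq, ← coe_lt_hit_iff (hX.rightCont ω),
    not_lt]

lemma massOn_killed (G F : Set 𝒳) (t : ℝ≥0) (x : 𝒳) : massOn (killed P X G) F t x =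
    (P x).real {ω | X t ω ∈ F ∧ ∀ u ≤ t, X u ω ∉ G} := by
  have h1 := hX.markov_killed_on x G F (s := 0) MeasurableSet.univ t
  simp only [Set.univ_inter, zero_add] at h1
  rw [h1, Finset.sum_eq_single x]
  · rw [hX.start, one_mul]
  · intro y _ hy
    have : (P x).real {ω | X 0 ω = y} = 0 := by
      rw [← hX.ae_start]
      convert measureReal_empty
      ext ω
      simp only [Set.mem_inter_iff, Set.mem_ofPred_eq, Set.mem_empty_iff_false, iff_false]
      rintro ⟨h1, h2⟩
      exact hy (h1.symm.trans h2)
    rw [this, zero_mul]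
  · simp

/-- Decomposition at the first visit to `B`: upper bound. -/
lemma massOn_killed_le (B G F : Set 𝒳) (s R : ℝ≥0) (x : 𝒳) {H U : ℝ}
    (hH : ∀ y, massOn (killed P X G) F s y ≤ H)
    (hU : ∀ u ≤ R, ∀ b ∈ B, massOn (killed P X G) F (s + u) b ≤ U) :
    massOn (killed P X G) F (s + R) x ≤
      mass (killed P X (B ∪ G)) R x * H + (P x).real (visits X B G R) * U := by
  have := hX.prob x
  set W := {ω | X (s + R) ω ∈ F ∧ ∀ u ≤ s + R, X u ω ∉ G} with hWdef
  set E := {ω | ∀ u ≤ R, X u ω ∉ B ∪ G} with hE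
  have hsub : W ⊆ (visits X B G R ∩ W) ∪
      (E ∩ {ω | X (R + s) ω ∈ F ∧ ∀ u ≤ s, X (R + u) ω ∉ G}) := by
    intro ω hω
    by_cases hv : ω ∈ visits X B G R
    · exact Or.inl ⟨hv, hω⟩
    · obtain ⟨h1, h2⟩ := hω
      refine Or.inr ⟨fun u hu hmem => ?_, ?_, ?_⟩
      · have huG : ∀ v ≤ R, X v ω ∉ G := fun v hv => h2 v (hv.trans le_add_self)
        rcases hmem with hB | hG
        · exact hv ⟨u, hu, hB, fun v hvu => huG v (hvu.trans hu)⟩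
        · exact huG u hu hG
      · rwa [add_comm]
      · exact fun u hu => h2 _ (by rw [add_comm]; gcongr)
  rw [hX.massOn_killed]
  refine (measureReal_mono hsub).trans ((measureReal_union_le _ _).trans ?_)
  rw [add_comm]
  refine add_le_add ?_ (hX.real_visits_bounds x B G F s R (L := 0)
    (fun u _ b _ => Finset.sum_nonneg fun y _ => Set.indicator_nonneg
      (fun z _ => killed_nonneg ..) y) hU).2
  rw [hX.markov_killed_on x G F (hX.measurableSet_noHit_past (B ∪ G) R), hX.mass_killed_eq,
    hX.real_eq_sum x R, Finset.sum_mul]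
  exact Finset.sum_le_sum fun y _ => mul_le_mul_of_nonneg_left (hH y) measureReal_nonneg

/-- Decomposition at the first visit to `B`: lower bound. -/
lemma visits_mul_le (B G : Set 𝒳) (s R : ℝ≥0) (x : 𝒳) {L : ℝ}
    (hL : ∀ b ∈ B, L ≤ mass (killed P X G) (s + R) b) :
    (P x).real (visits X B G R) * L ≤
      (P x).real (visits X B G R ∩ {ω | ∀ u ≤ s + R, X u ω ∉ G}) := by
  have h1 := (hX.real_visits_bounds x B G Set.univ s R (L := L) (U := 1) (fun u hu b hb => by
    rw [massOn_univ]
    exact (hL b hb).trans (hX.mass_killed_anti G (by gcongr) b)) (fun u hu b hb => by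
    rw [massOn_univ]
    exact hX.mass_killed_le_one G _ b)).1
  simpa using h1

lemma mass_sub_le_visits (B G : Set 𝒳) (R : ℝ≥0) (x : 𝒳) :
    mass (killed P X G) R x - mass (killed P X (B ∪ G)) R x ≤ (P x).real (visits X B G R) := by
  have := hX.prob x
  rw [sub_le_iff_le_add, hX.mass_killed_eq, hX.mass_killed_eq]
  refine le_trans (measureReal_mono ?_) (measureReal_union_le _ _)
  intro ω hω
  by_cases hv : ω ∈ visits X B G R
  · exact Or.inl hv
  · refine Or.inr fun u hu hmem => ?_
    rcases hmem with hB | hG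
    · exact hv ⟨u, hu, hB, fun v hvu => hω v (hvu.trans hu)⟩
    · exact hω u hu hG

lemma visits_inter_survive (B G : Set 𝒳) (R : ℝ≥0) :
    {ω | ((2 * R : ℝ≥0) : ℝ≥0∞) < hit X G ω ∧ hit X (G ∪ B) ω ≤ (R : ℝ≥0∞)} =
      visits X B G R ∩ {ω | ∀ u ≤ R + R, X u ω ∉ G} := by
  ext ω
  have h1 := coe_lt_hit_iff (hX.rightCont ω) (G ∪ B) R
  simp only [Set.mem_ofPred_eq, Set.mem_inter_iff, coe_lt_hit_iff (hX.rightCont ω) G,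
    ← not_lt (b := hit X (G ∪ B) ω), h1, ← two_mul, visits]
  push Not
  constructor
  · rintro ⟨h2, u, hu, hmem⟩
    have hle : R ≤ 2 * R := by rw [two_mul]; exact le_self_add
    refine ⟨⟨u, hu, hmem.resolve_left (h2 u (hu.trans hle)),
      fun v hv => h2 v ((hv.trans hu).trans hle)⟩, h2⟩
  · rintro ⟨⟨u, hu, hB, -⟩, h2⟩
    exact ⟨h2, u, hu, Or.inr hB⟩

end

variable {P' : 𝒳 → Measure Ω'} {X' : ℝ≥0 → Ω' → 𝒳} {π : 𝒳 → ℝ}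

lemma sum_stationary (hX : IsMarkovChain Q P X) (hX' : IsMarkovChain (reversedRates Q π) P' X')
    (hπ : ∀ x, 0 < π x) (t : ℝ≥0) (y : 𝒳) : ∑ x, π x * killed P X ∅ t x y = π y := by
  simp only [hX.killed_reversed hX' hπ]
  rw [← Finset.mul_sum]
  have := hX'.mass_killed_empty t y
  rw [mass] at this
  rw [this, mul_one]

lemma sum_mass_reversed (hX : IsMarkovChain Q P X)
    (hX' : IsMarkovChain (reversedRates Q π) P' X') (hπ : ∀ x, 0 < π x) (G : Set 𝒳) (t : ℝ≥0) :
    ∑ x, π x * mass (killed P X G) t x = ∑ x, π x * mass (killed P' X' G) t x := by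
  simp only [mass, Finset.mul_sum, hX.killed_reversed hX' hπ]
  exact Finset.sum_comm

end IsMarkovChain

end HittingTime

end

noncomputable section

/-! ### The killed chain is a return kernel. -/

namespace HittingTime

lemma cBar_nonneg {α f r : ℝ} (hc : 0 ≤ r + 2 * f ^ α) : 0 ≤ cBar α f r := by
  rw [cBar, sub_nonneg, Real.sqrt_le_iff]
  constructor
  · norm_num
  · linarith

/-- Of `eps2` the estimates need only these three terms; `cBar` matters through its sign. -/
lemma le_eps2 {α d f r : ℝ} (hf : 0 ≤ f) (hr : 0 ≤ r) :
    4 * f ^ α + 4 * d + f ^ (1 - α) ≤ eps2 α d f r := by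
  have h1 := cBar_nonneg (α := α) (f := f) (r := r) (by positivity)
  rw [eps2]
  linarith

section

variable {𝒳 Ω Ω' : Type*} [MeasurableSpace Ω] [MeasurableSpace Ω'] [Fintype 𝒳] [DecidableEq 𝒳]
  {Q : Matrix 𝒳 𝒳 ℝ} {P : 𝒳 → Measure Ω} {X : ℝ≥0 → Ω → 𝒳}
  {P' : 𝒳 → Measure Ω'} {X' : ℝ≥0 → Ω' → 𝒳} {π : 𝒳 → ℝ} {G : Set 𝒳} {α : ℝ} {R : ℝ≥0}
  {d f r : ℝ}

lemma mass_ge_of_mem_basin (hX : IsMarkovChain Q P X) {x : 𝒳}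
    (hx : x ∈ basin P X P' X' G R f α) : 1 - 2 * f ^ α ≤ mass (killed P X G) (2 * R) x := by
  have h1 := hx.2
  rw [hX.real_hit_le] at h1
  have h2 : 0 ≤ (P' x).real {ω | hit X' G ω ≤ ((2 * R : ℝ≥0) : ℝ≥0∞)} := measureReal_nonneg
  linarith

/-- Thermalization is assumed for the free chain; killing removes at most `2 * f ^ α` of mass from
each of the two laws. -/
lemma sum_abs_killed_sub_le (hX : IsMarkovChain Q P X) (hH : HpG P X P' X' π G α R d f r)
    {x x' : 𝒳} (hx : x ∈ basin P X P' X' G R f α) (hx' : x' ∈ basin P X P' X' G R f α) :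
    ∑ y, |killed P X G R x y - killed P X G R x' y| ≤ 2 * d + 4 * f ^ α := by
  have hT := hH.thermalization x hx x' hx'
  rw [dTV] at hT
  simp only [hX.evol_eq] at hT
  have hloss : ∀ z ∈ basin P X P' X' G R f α,
      ∑ y, (killed P X ∅ R z y - killed P X G R z y) ≤ 2 * f ^ α := by
    intro z hz
    rw [Finset.sum_sub_distrib]
    have h1 := hX.mass_killed_empty R z
    have h2 := mass_ge_of_mem_basin hX hz
    have h3 := hX.mass_killed_anti G (show R ≤ 2 * R by rw [two_mul]; exact le_self_add) z
    simp only [mass] at h1 h2 h3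
    linarith
  have hpt : ∀ y, |killed P X G R x y - killed P X G R x' y| ≤
      |killed P X ∅ R x y - killed P X ∅ R x' y| + (killed P X ∅ R x y - killed P X G R x y) +
        (killed P X ∅ R x' y - killed P X G R x' y) := by
    intro y
    have h1 := hX.killed_mono (Set.empty_subset G) R x y
    have h2 := hX.killed_mono (Set.empty_subset G) R x' y
    have h3 := le_abs_self (killed P X ∅ R x y - killed P X ∅ R x' y)
    have h4 := neg_abs_le (killed P X ∅ R x y - killed P X ∅ R x' y)
    rw [abs_le]
    constructor <;> linarith
  refine (Finset.sum_le_sum fun y _ => hpt y).trans ?_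
  rw [Finset.sum_add_distrib, Finset.sum_add_distrib]
  linarith [hloss x hx, hloss x' hx']

variable (hX : IsMarkovChain Q P X) (hX' : IsMarkovChain (reversedRates Q π) P' X')
  (hπ : ∀ x, 0 < π x) (hGc : Gᶜ.Nonempty) (hH : HpG P X P' X' π G α R d f r)
include hX hX' hπ hGc hH

/-- Most of the mass of `π` in `A` lies in the basin. -/
lemma restricted_compl_basin_le :
    ∑ x, (basin P X P' X' G R f α)ᶜ.indicator (restricted π Gᶜ) x ≤ f ^ (1 - α) := by
  set B := basin P X P' X' G R f α with hB
  set ν := restricted π Gᶜ with hν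
  have hν0 : ∀ x, 0 ≤ ν x := restricted_nonneg hπ hGc
  have hν1 : ∑ x, ν x = 1 := sum_restricted hπ hGc
  have hf := hH.f_mem.1
  have hslow := hH.slowEscape
  rw [SlowEscape, real_fromLaw hX.prob hν0] at hslow
  simp only [hX.real_hit_le] at hslow
  -- Slow escape is assumed for the forward chain only. Duality transfers it to the reversed one, so
  -- the symmetrized escape probability has mean at most `f`; Markov's inequality at level `f ^ α`
  -- then leaves `f / f ^ α`.
  have hrev : ∑ x, ν x * mass (killed P X G) (2 * R) x =
      ∑ x, ν x * mass (killed P' X' G) (2 * R) x := by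
    rw [sum_restricted_mul, sum_restricted_mul, hX.sum_mass_reversed hX' hπ]
    · intro x hx
      exact Finset.sum_eq_zero fun y _ => hX'.killed_of_mem (by simpa using hx) _ _
    · intro x hx
      exact Finset.sum_eq_zero fun y _ => hX.killed_of_mem (by simpa using hx) _ _
  set a : 𝒳 → ℝ := fun x => 1 / 2 * ((1 - mass (killed P X G) (2 * R) x) +
    (1 - mass (killed P' X' G) (2 * R) x)) with ha
  have ha0 : ∀ x, 0 ≤ a x := fun x => by
    have h1 := hX.mass_killed_le_one G (2 * R) x
    have h2 := hX'.mass_killed_le_one G (2 * R) x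
    simp only [ha]; linarith
  have hsum : ∑ x, ν x * a x ≤ f := by
    have e : ∑ x, ν x * a x = ∑ x, ν x - 1 / 2 * ∑ x, ν x * mass (killed P X G) (2 * R) x -
        1 / 2 * ∑ x, ν x * mass (killed P' X' G) (2 * R) x := by
      rw [Finset.mul_sum, Finset.mul_sum, ← Finset.sum_sub_distrib,
        ← Finset.sum_sub_distrib]
      exact Finset.sum_congr rfl fun x _ => by simp only [ha]; ring
    have e2 : ∑ x, ν x * (1 - mass (killed P X G) (2 * R) x) =
        ∑ x, ν x - ∑ x, ν x * mass (killed P X G) (2 * R) x := by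
      rw [← Finset.sum_sub_distrib]
      exact Finset.sum_congr rfl fun x _ => by ring
    rw [e2, hν1] at hslow
    rw [e, ← hrev, hν1]
    linarith
  have hmarkov : (∑ x, Bᶜ.indicator ν x) * f ^ α ≤ ∑ x, ν x * a x := by
    rw [Finset.sum_mul]
    refine Finset.sum_le_sum fun x _ => ?_
    by_cases hx : x ∈ B
    · rw [Set.indicator_of_notMem (by simpa using hx), zero_mul]
      exact mul_nonneg (hν0 x) (ha0 x)
    · rw [Set.indicator_of_mem (by simpa using hx)]
      by_cases hxG : x ∈ G
      · have : ν x = 0 := by simp [hν, restricted, hxG]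
        rw [this, zero_mul, zero_mul]
      · refine mul_le_mul_of_nonneg_left ?_ (hν0 x)
        by_contra! hlt
        refine hx ⟨hxG, ?_⟩
        rw [hX.real_hit_le, hX'.real_hit_le]
        exact hlt.le
  have hfα : 0 < f ^ α := Real.rpow_pos_of_pos hf α
  rw [Real.rpow_sub hf, Real.rpow_one, le_div_iff₀ hfα]
  exact hmarkov.trans hsum

lemma restricted_basin_ge :
    1 - f ^ (1 - α) ≤ ∑ x, (basin P X P' X' G R f α).indicator (restricted π Gᶜ) x := by
  have h1 := restricted_compl_basin_le hX hX' hπ hGc hH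
  have h2 : ∑ x, (basin P X P' X' G R f α).indicator (restricted π Gᶜ) x +
      ∑ x, (basin P X P' X' G R f α)ᶜ.indicator (restricted π Gᶜ) x = 1 := by
    rw [← Finset.sum_add_distrib, ← sum_restricted hπ hGc]
    exact Finset.sum_congr rfl fun x _ => Set.indicator_self_add_compl_apply _ _ x
  linarith

/-- After a time `R` the chain started in the basin is rarely outside the basin. -/
lemma massOn_compl_basin_le (hsmall : f ^ (1 - α) ≤ 1 / 2) (u : ℝ≥0) {b : 𝒳}
    (hb : b ∈ basin P X P' X' G R f α) :
    massOn (killed P X G) (basin P X P' X' G R f α)ᶜ (R + u) b ≤ 2 * d + 2 * f ^ (1 - α) := by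
  set B := basin P X P' X' G R f α with hB
  set ν := restricted π Gᶜ with hν
  set Z := ∑ z, Gᶜ.indicator π z
  have hZ : 0 < Z := sum_indicator_pos hπ hGc
  have hν0 : ∀ x, 0 ≤ ν x := restricted_nonneg hπ hGc
  have hd := hH.d_mem.1
  -- Passing to the free chain makes stationarity available, and excluding `G` from the target makes
  -- its stationary weight, relative to that of `Gᶜ`, the small weight outside the basin.
  set D : Set 𝒳 := (B ∪ G)ᶜ with hD
  have hTadd := hX.killed_add ∅
  have hon0 : ∀ (G : Set 𝒳) F t x, 0 ≤ massOn (killed P X G) F t x := fun G F t x =>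
    Finset.sum_nonneg fun y _ => Set.indicator_nonneg (fun z _ => killed_nonneg ..) y
  have hon1 : ∀ F t x, massOn (killed P X ∅) F t x ≤ 1 := fun F t x => by
    refine le_trans (Finset.sum_le_sum fun y _ => ?_) (hX.mass_killed_empty t x).le
    exact Set.indicator_le_self' (fun _ _ => killed_nonneg ..) y
  have hmono : massOn (killed P X G) Bᶜ (R + u) b ≤ massOn (killed P X ∅) D (R + u) b := by
    refine Finset.sum_le_sum fun y _ => ?_
    by_cases hyB : y ∈ B
    · rw [Set.indicator_of_notMem (by simpa using hyB)]
      exact Set.indicator_nonneg (fun z _ => killed_nonneg ..) y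
    · rw [Set.indicator_of_mem (by simpa using hyB)]
      by_cases hyG : y ∈ G
      · rw [hX.killed_apply_mem hyG]
        exact Set.indicator_nonneg (fun z _ => killed_nonneg ..) y
      · rw [Set.indicator_of_mem (by simp [hD, hyB, hyG])]
        exact hX.killed_mono (Set.empty_subset G) _ _ _
  have hsplit : ∀ x, massOn (killed P X ∅) D (R + u) x =
      ∑ y, killed P X ∅ R x y * massOn (killed P X ∅) D u y := by
    intro x
    simp only [massOn, Finset.mul_sum]
    rw [Finset.sum_comm]
    refine Finset.sum_congr rfl fun z _ => ?_
    by_cases hz : z ∈ D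
    · simp only [Set.indicator_of_mem hz, hTadd, Matrix.mul_apply]
    · simp [Set.indicator_of_notMem hz]
  have hclose : ∀ b' ∈ B, massOn (killed P X ∅) D (R + u) b ≤
      massOn (killed P X ∅) D (R + u) b' + 2 * d := by
    intro b' hb'
    have hT := hH.thermalization b hb b' hb'
    rw [dTV] at hT
    simp only [hX.evol_eq] at hT
    rw [hsplit, hsplit, ← sub_le_iff_le_add', ← Finset.sum_sub_distrib]
    refine le_trans (Finset.sum_le_sum (g := fun y => |killed P X ∅ R b y - killed P X ∅ R b' y|)
      fun y _ => ?_) (by linarith)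
    rw [← sub_mul]
    refine (mul_le_mul_of_nonneg_right (le_abs_self _) (hon0 ∅ D u y)).trans ?_
    exact mul_le_of_le_one_right (abs_nonneg _) (hon1 D u y)
  have hstat : ∑ x, ν x * massOn (killed P X ∅) D (R + u) x ≤ ∑ x, Bᶜ.indicator ν x := by
    calc ∑ x, ν x * massOn (killed P X ∅) D (R + u) x
        ≤ ∑ x, π x / Z * massOn (killed P X ∅) D (R + u) x := by
          refine Finset.sum_le_sum fun x _ => mul_le_mul_of_nonneg_right ?_ (hon0 ∅ D _ x)
          exact div_le_div_of_nonneg_right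
            (Set.indicator_le_self' (fun _ _ => (hπ _).le) x) hZ.le
      _ = ∑ y, D.indicator (fun y => π y / Z) y := by
          simp only [massOn, Finset.mul_sum]
          rw [Finset.sum_comm]
          refine Finset.sum_congr rfl fun y _ => ?_
          by_cases hy : y ∈ D
          · simp only [Set.indicator_of_mem hy]
            rw [← hX.sum_stationary hX' hπ (R + u) y, Finset.sum_div]
            exact Finset.sum_congr rfl fun x _ => by ring
          · simp [Set.indicator_of_notMem hy]
      _ ≤ ∑ x, Bᶜ.indicator ν x := by
          refine Finset.sum_le_sum fun y _ => ?_
          by_cases hy : y ∈ D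
          · have hyB : y ∈ Bᶜ := fun h => hy (Or.inl h)
            have hyG : y ∈ Gᶜ := fun h => hy (Or.inr h)
            rw [Set.indicator_of_mem hy, Set.indicator_of_mem hyB, hν, restricted,
              Set.indicator_of_mem hyG]
          · rw [Set.indicator_of_notMem hy]
            exact Set.indicator_nonneg (fun z _ => hν0 z) y
  have hout := restricted_compl_basin_le hX hX' hπ hGc hH
  have hin := restricted_basin_ge hX hX' hπ hGc hH
  -- Up to `2 * d` the start `b` is no worse than the average over the basin. The basin has weight
  -- at least 1/2, which costs the factor 2 in the bound.
  have havg : (∑ x, B.indicator ν x) * (massOn (killed P X ∅) D (R + u) b - 2 * d) ≤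
      ∑ x, ν x * massOn (killed P X ∅) D (R + u) x := by
    rw [Finset.sum_mul]
    refine Finset.sum_le_sum fun x _ => ?_
    by_cases hx : x ∈ B
    · rw [Set.indicator_of_mem hx]
      exact mul_le_mul_of_nonneg_left (by linarith [hclose x hx]) (hν0 x)
    · rw [Set.indicator_of_notMem hx, zero_mul]
      exact mul_nonneg (hν0 x) (hon0 ∅ D _ x)
  refine hmono.trans ?_
  by_contra! hlt
  have h1 : 2 * f ^ (1 - α) < massOn (killed P X ∅) D (R + u) b - 2 * d := by linarith
  have hfp : 0 < f ^ (1 - α) := Real.rpow_pos_of_pos hH.f_mem.1 _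
  nlinarith [havg.trans (hstat.trans hout)]

/-- The bound 1/200 is what makes κ at most 1/100. The factor 2 in κ is used for `leave`, where
missing the basin costs `r` and being outside it after a visit costs `2 * d + 2 * f ^ (1 - α)`. -/
theorem isReturnKernel_killed (hη : r + eps2 α d f r ≤ 1 / 200) :
    IsReturnKernel (killed P X G) (basin P X P' X' G R f α)
      (fun x => (P x).real (visits X (basin P X P' X' G R f α) G R)) R
      (2 * (r + eps2 α d f r)) := by
  have hd := hH.d_mem.1
  have hr := hH.r_mem.1
  have hf := hH.f_mem.1
  have heps := le_eps2 (α := α) (d := d) hf.le hr.le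
  have hfα : 0 < f ^ α := Real.rpow_pos_of_pos hf α
  have hfα' : 0 < f ^ (1 - α) := Real.rpow_pos_of_pos hf _
  have hrec : ∀ x, mass (killed P X (basin P X P' X' G R f α ∪ G)) R x ≤ r := fun x => by
    rw [hX.mass_killed]
    exact (hH.recurrence x).le
  have hq1 : ∀ x, (P x).real (visits X (basin P X P' X' G R f α) G R) ≤ 1 := fun x => by
    have := hX.prob x
    exact measureReal_le_one
  refine ⟨by linarith, by linarith, lt_trans one_pos hH.R_gt, killed_nonneg P X G, hX.killed_add G,
    hX.mass_killed_le_one G, ?_, fun x => measureReal_nonneg, hq1, ?_, ?_, ?_, ?_, ?_, ?_⟩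
  · by_contra hne
    rw [Set.not_nonempty_iff_eq_empty] at hne
    have h1 := restricted_basin_ge hX hX' hπ hGc hH
    simp only [hne, Set.indicator_empty, Finset.sum_const_zero] at h1
    linarith
  · intro s x L hL
    have := hX.prob x
    refine (hX.visits_mul_le _ G s R x hL).trans ?_
    rw [hX.mass_killed_eq]
    exact measureReal_mono Set.inter_subset_right
  · intro s x H U hHb hU
    have h1 := hX.massOn_killed_le (basin P X P' X' G R f α) G Set.univ s R x (H := H) (U := U)
      (fun y => by rw [massOn_univ]; exact hHb y)
      (fun u _ b hb => by
        rw [massOn_univ]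
        exact (hX.mass_killed_anti G le_self_add b).trans (hU b hb))
    rw [massOn_univ] at h1
    refine h1.trans (add_le_add_left (mul_le_mul_of_nonneg_right ?_ ?_) _)
    · linarith [hrec x]
    · exact le_trans (Finset.sum_nonneg fun y _ => killed_nonneg P X G s x y) (hHb x)
  · intro x
    linarith [hX.mass_sub_le_visits (basin P X P' X' G R f α) G R x, hrec x]
  · intro b hb
    linarith [mass_ge_of_mem_basin hX hb]
  · intro x hx x' hx'
    linarith [sum_abs_killed_sub_le hX hH hx hx']
  · intro x
    have h1 := hX.massOn_killed_le (basin P X P' X' G R f α) G (basin P X P' X' G R f α)ᶜ R R x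
      (H := 1) (U := 2 * d + 2 * f ^ (1 - α))
      (fun y => le_trans (Finset.sum_le_sum fun z _ =>
        Set.indicator_le_self' (fun _ _ => killed_nonneg ..) z) (hX.mass_killed_le_one G R y))
      (fun u _ b hb => massOn_compl_basin_le hX hX' hπ hGc hH (by linarith) u hb)
    rw [← two_mul, mul_one] at h1
    have h2 : (P x).real (visits X (basin P X P' X' G R f α) G R) * (2 * d + 2 * f ^ (1 - α)) ≤
        2 * d + 2 * f ^ (1 - α) := mul_le_of_le_one_left (by positivity) (hq1 x)
    change massOn (killed P X G) (basin P X P' X' G R f α)ᶜ (2 * R) x ≤ _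
    linarith [hrec x]

end

end HittingTime

end

noncomputable section

/-! ### Exponential tails and the mean exit time. -/

namespace HittingTime

lemma exists_exp_rate {E : ℝ≥0 → ℝ} (hpos : ∀ t, 0 < E t) (hanti : Antitone E)
    (hadd : ∀ s t, E (s + t) = E s * E t) {t₀ : ℝ≥0} (hlt : E t₀ < 1) :
    ∃ l > 0, ∀ t : ℝ≥0, E t = Real.exp (-(l * t)) := by
  set L : ℝ≥0 → ℝ := fun t => -Real.log (E t) with hL
  have hLadd : ∀ s t, L (s + t) = L s + L t := fun s t => by
    simp only [hL, hadd, Real.log_mul (hpos s).ne' (hpos t).ne']; ring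
  have hLmono : Monotone L := fun s t hst =>
    neg_le_neg (Real.log_le_log (hpos t) (hanti hst))
  have hL0 : L 0 = 0 := by have := hLadd 0 0; simp at this; exact this
  have hLn : ∀ (n : ℕ) t, L (n * t) = n * L t := by
    intro n t
    induction n with
    | zero => simp [hL0]
    | succ n ih => rw [Nat.cast_succ, add_mul, one_mul, hLadd, ih]; push_cast; ring
  have hLn1 : ∀ n : ℕ, L n = n * L 1 := fun n => by simpa using hLn n 1
  have h1 : 0 ≤ L 1 := hL0 ▸ hLmono zero_le
  have hlin : ∀ t : ℝ≥0, L t = L 1 * t := by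
    intro t
    -- An additive monotone function is linear: rounding `n * t` to integers costs at most `L 1`,
    -- whatever `n`, so no continuity is needed.
    have hb : ∀ n : ℕ, n * |L t - L 1 * t| ≤ L 1 := by
      intro n
      have hlo := hLmono (Nat.floor_le (zero_le (a := (n : ℝ≥0) * t)))
      have hhi := hLmono (Nat.lt_floor_add_one ((n : ℝ≥0) * t)).le
      have hlo' : ((⌊(n : ℝ≥0) * t⌋₊ : ℝ≥0) : ℝ) ≤ ((n : ℝ≥0) * t : ℝ≥0) :=
        NNReal.coe_le_coe.mpr (Nat.floor_le zero_le)
      have hhi' : (((n : ℝ≥0) * t : ℝ≥0) : ℝ) ≤ ((⌊(n : ℝ≥0) * t⌋₊ + 1 : ℝ≥0) : ℝ) :=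
        NNReal.coe_le_coe.mpr (Nat.lt_floor_add_one _).le
      push_cast at hlo' hhi'
      rw [hLn1, hLn] at hlo
      rw [hLadd, hLn1, hLn] at hhi
      rw [← abs_of_nonneg (Nat.cast_nonneg (α := ℝ) n), ← abs_mul, abs_le]
      constructor <;> nlinarith
    by_contra hne
    have hp : 0 < |L t - L 1 * t| := abs_pos.mpr (sub_ne_zero.mpr hne)
    obtain ⟨n, hn⟩ := exists_nat_gt (L 1 / |L t - L 1 * t|)
    rw [div_lt_iff₀ hp] at hn
    exact absurd (hb n) (not_le.mpr hn)
  refine ⟨L 1, lt_of_le_of_ne h1 fun h0 => ?_, fun t => ?_⟩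
  · have h2 : 0 < L t₀ := neg_pos.mpr (Real.log_neg (hpos t₀) hlt)
    rw [hlin, ← h0, zero_mul] at h2
    exact lt_irrefl _ h2
  · rw [← hlin, hL, neg_neg, Real.exp_log (hpos t)]

section

variable {𝒳 Ω : Type*} [MeasurableSpace Ω] [Fintype 𝒳] [DecidableEq 𝒳]
  {Q : Matrix 𝒳 𝒳 ℝ} {P : 𝒳 → Measure Ω} {X : ℝ≥0 → Ω → 𝒳}

lemma IsMarkovChain.measurable_hit (hX : IsMarkovChain Q P X) (G : Set 𝒳) :
    Measurable (hit X G) := by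
  refine measurable_of_Ioi fun a => ?_
  induction a using ENNReal.recTopCoe with
  | top => simp
  | coe a =>
    have : hit X G ⁻¹' Set.Ioi (a : ℝ≥0∞) = {ω | ∀ u ≤ a, X u ω ∉ G} := by
      ext ω
      exact coe_lt_hit_iff (hX.rightCont ω) G a
    rw [this]
    exact hX.measurableSet_survive G a

/-- The mean of a random time with exponential tails. -/
lemma lintegral_eq_of_exp_tail {m : Measure Ω} [IsFiniteMeasure m] {τ : Ω → ℝ≥0∞}
    (hτ : Measurable τ) {l : ℝ} (hl : 0 < l)
    (htail : ∀ t : ℝ≥0, m.real {ω | (t : ℝ≥0∞) < τ ω} = Real.exp (-(l * t))) :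
    ∫⁻ ω, τ ω ∂m = ENNReal.ofReal (1 / l) := by
  have htop : ∀ᵐ ω ∂m, τ ω ≠ ⊤ := by
    have h0 : m.real {ω | τ ω = ⊤} ≤ 0 := by
      have hlim : Tendsto (fun n : ℕ => Real.exp (-(l * (n : ℝ≥0)))) atTop (𝓝 0) := by
        refine Real.tendsto_exp_neg_atTop_nhds_zero.comp ?_
        simpa using (tendsto_natCast_atTop_atTop (R := ℝ)).const_mul_atTop hl
      refine ge_of_tendsto' hlim fun n => ?_
      rw [← htail]
      exact measureReal_mono fun ω hω => by
        change ((n : ℝ≥0) : ℝ≥0∞) < τ ω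
        rw [show τ ω = ⊤ from hω]
        exact ENNReal.coe_lt_top
    have h1 : m {ω | τ ω = ⊤} = 0 := by
      rw [← measureReal_eq_zero_iff]
      exact le_antisymm h0 measureReal_nonneg
    simpa [ae_iff] using h1
  have h1 : ∫⁻ ω, τ ω ∂m = ∫⁻ ω, ENNReal.ofReal (τ ω).toReal ∂m := by
    refine lintegral_congr_ae ?_
    filter_upwards [htop] with ω hω
    rw [ENNReal.ofReal_toReal hω]
  rw [h1, lintegral_eq_lintegral_meas_lt m (ae_of_all _ fun ω => ENNReal.toReal_nonneg)
    hτ.ennreal_toReal.aemeasurable]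
  have h2 : ∀ t ∈ Set.Ioi (0 : ℝ), m {ω | t < (τ ω).toReal} =
      ENNReal.ofReal (Real.exp (-l * t)) := by
    intro t ht
    have h3 : m {ω | t < (τ ω).toReal} = m {ω | (t.toNNReal : ℝ≥0∞) < τ ω} := by
      refine measure_congr ?_
      filter_upwards [htop] with ω hω
      refine propext ?_
      change t < (τ ω).toReal ↔ (ENNReal.ofReal t) < τ ω
      rw [ENNReal.ofReal_lt_iff_lt_toReal (le_of_lt ht) hω]
    rw [h3, ← ofReal_measureReal, htail, Real.coe_toNNReal t (le_of_lt ht), neg_mul]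
  rw [setLIntegral_congr_fun measurableSet_Ioi h2,
    ← ofReal_integral_eq_lintegral_ofReal (integrableOn_exp_mul_Ioi (neg_lt_zero.mpr hl) 0)
      (ae_of_all _ fun t => (Real.exp_pos _).le), integral_exp_mul_Ioi (neg_lt_zero.mpr hl)]
  congr 1
  simp

end

end HittingTime

end

noncomputable section

/-! ### Rescaled hitting times and conclusion. -/

namespace HittingTime

lemma setOf_le_div_eq {Ω : Type*} (τ : Ω → ℝ≥0∞) {t T : ℝ} (ht : 0 ≤ t) (hT : 0 < T) :
    {ω | ENNReal.ofReal t ≤ τ ω / ENNReal.ofReal T} =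
      {ω | ((t * T).toNNReal : ℝ≥0∞) ≤ τ ω} := by
  ext ω
  change ENNReal.ofReal t ≤ τ ω / ENNReal.ofReal T ↔ ENNReal.ofReal (t * T) ≤ τ ω
  rw [ENNReal.le_div_iff_mul_le (Or.inl (ENNReal.ofReal_pos.mpr hT).ne')
    (Or.inl ENNReal.ofReal_ne_top), ENNReal.ofReal_mul ht]

section

variable {𝒳 Ω : Type*} [MeasurableSpace Ω] [Fintype 𝒳] [DecidableEq 𝒳]
  {Q : Matrix 𝒳 𝒳 ℝ} {P : 𝒳 → Measure Ω} {X : ℝ≥0 → Ω → 𝒳} {G : Set 𝒳} {μ : 𝒳 → ℝ}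

lemma condEvol_fromLaw (hX : IsMarkovChain Q P X) {ν : 𝒳 → ℝ} (hν : ∀ x, 0 ≤ ν x) (G : Set 𝒳)
    (t : ℝ≥0) (y : 𝒳) : condEvol (fromLaw P ν) X G t y =
      (∑ x, ν x * killed P X G t x y) / ∑ x, ν x * mass (killed P X G) t x := by
  rw [condEvol, real_fromLaw hX.prob hν, real_fromLaw hX.prob hν]
  simp only [hX.mass_killed]
  rfl

lemma isQuasiStationary_of_tendsto (hX : IsMarkovChain Q P X) {π : 𝒳 → ℝ} (hπ : ∀ x, 0 < π x)
    {b : 𝒳} (hb : b ∈ Gᶜ)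
    (hlim : ∀ ν : 𝒳 → ℝ, (∀ x, 0 ≤ ν x) → ∑ x, ν x = 1 →
      ∀ c > 0, (∀ t, c * mass (killed P X G) t b ≤ ∑ x, ν x * mass (killed P X G) t x) →
      ∀ y, Tendsto (fun t => (∑ x, ν x * killed P X G t x y) /
        (∑ x, ν x * mass (killed P X G) t x)) atTop (𝓝 (μ y))) :
    IsQuasiStationary P X π G μ := by
  have hν0 : ∀ x, 0 ≤ restricted π Gᶜ x := restricted_nonneg hπ ⟨b, hb⟩
  have hm0 : ∀ t x, 0 ≤ mass (killed P X G) t x := fun t x =>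
    Finset.sum_nonneg fun y _ => killed_nonneg ..
  refine tendsto_pi_nhds.mpr fun y => ?_
  simp only [condEvol_fromLaw hX hν0]
  refine hlim _ hν0 (sum_restricted hπ ⟨b, hb⟩) (restricted π Gᶜ b) ?_ (fun t => ?_) y
  · rw [restricted, Set.indicator_of_mem hb]
    exact div_pos (hπ b) (sum_indicator_pos hπ ⟨b, hb⟩)
  · exact Finset.single_le_sum (f := fun x => restricted π Gᶜ x * mass (killed P X G) t x)
      (fun x _ => mul_nonneg (hν0 x) (hm0 t x)) (Finset.mem_univ b)

lemma isAveragedLimit_of_tendsto (hX : IsMarkovChain Q P X) {π : 𝒳 → ℝ} (hπ : ∀ x, 0 < π x)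
    {b : 𝒳} (hb : b ∈ Gᶜ) (hirr : IsIrreducibleOn Q Gᶜ)
    (hlim : ∀ ν : 𝒳 → ℝ, (∀ x, 0 ≤ ν x) → ∑ x, ν x = 1 →
      ∀ c > 0, (∀ t, c * mass (killed P X G) t b ≤ ∑ x, ν x * mass (killed P X G) t x) →
      ∀ y, Tendsto (fun t => (∑ x, ν x * killed P X G t x y) /
        (∑ x, ν x * mass (killed P X G) t x)) atTop (𝓝 (μ y))) :
    IsAveragedLimit P X π G μ := by
  refine tendsto_pi_nhds.mpr fun y => ?_
  have hterm : ∀ x, Tendsto (fun t => restricted π Gᶜ x * condEvol (P x) X G t y) atTop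
      (𝓝 (restricted π Gᶜ x * μ y)) := by
    intro x
    by_cases hx : x ∈ G
    · have : restricted π Gᶜ x = 0 := by simp [restricted, hx]
      simp [this]
    · refine Tendsto.const_mul _ ?_
      -- Reaching the basin point `b` alive with positive probability gives the constant `c`
      -- required of the Dirac mass at `x`.
      obtain ⟨t₀, ht₀⟩ := hX.exists_killed_pos hx (hirr x hx b hb)
      have h1 := hlim (Pi.single x 1) (fun z => by
          rw [Pi.single_apply]; split_ifs <;> norm_num) (by simp) _ ht₀ (fun t => by
          simp only [Pi.single_apply, ite_mul, one_mul, zero_mul, Finset.sum_ite_eq',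
            Finset.mem_univ, if_true]
          refine le_trans ?_ (hX.mass_killed_anti G (le_add_self (b := t₀)) x)
          rw [hX.mass_killed_add]
          exact Finset.single_le_sum (f := fun z => killed P X G t₀ x z * mass (killed P X G) t z)
            (fun z _ => mul_nonneg (killed_nonneg ..)
              (Finset.sum_nonneg fun _ _ => killed_nonneg ..)) (Finset.mem_univ b)) y
      simp only [Pi.single_apply, ite_mul, one_mul, zero_mul, Finset.sum_ite_eq',
        Finset.mem_univ, if_true] at h1
      refine h1.congr fun t => ?_
      rw [condEvol, hX.mass_killed]
      rfl
  have h2 := tendsto_finsetSum Finset.univ fun x (_ : x ∈ Finset.univ) => hterm x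
  rwa [← Finset.sum_mul, sum_restricted hπ ⟨b, hb⟩, one_mul] at h2

/-- An estimate for the survival probabilities gives one for the rescaled hitting time. -/
lemma abs_real_le_hit_div_sub_le (hX : IsMarkovChain Q P X) {ν : 𝒳 → ℝ}
    (hν1 : ∑ x, ν x = 1) {l : ℝ} (hl : 0 < l) {E : ℝ≥0 → ℝ}
    (hE : ∀ t : ℝ≥0, E t = Real.exp (-(l * t))) {ε : ℝ} (hε : 0 ≤ ε)
    (hest : ∀ s, |∑ x, ν x * mass (killed P X G) s x - E s| ≤ ε * E s) {t : ℝ} (ht : 0 ≤ t) :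
    |∑ x, ν x * (P x).real {ω | ENNReal.ofReal t ≤ hit X G ω / ENNReal.ofReal (1 / l)} -
      Real.exp (-t)| ≤ ε * Real.exp (-t) := by
  rw [setOf_le_div_eq (hit X G) ht (one_div_pos.mpr hl)]
  rcases ht.eq_or_lt with rfl | ht0
  -- Time 0 is separate: the identity between the events with `≤` and `<` holds only at positive
  -- times.
  · have : ∀ x, (P x).real {ω | (((0 : ℝ) * (1 / l)).toNNReal : ℝ≥0∞) ≤ hit X G ω} = 1 :=
      fun x => by
        have := hX.prob x
        simp
    simp only [this, mul_one, hν1, neg_zero, Real.exp_zero, sub_self, abs_zero]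
    exact hε
  · have hpos : 0 < t * (1 / l) := by positivity
    have hs := hest (t * (1 / l)).toNNReal
    have he : E (t * (1 / l)).toNNReal = Real.exp (-t) := by
      rw [hE, Real.coe_toNNReal _ hpos.le]
      congr 1
      field_simp
    simp only [hX.real_le_hit_eq (Real.toNNReal_pos.mpr hpos)]
    rwa [he] at hs

end

end HittingTime

end

open HittingTime in
theorem theorem3p6 :
    ∃ C η : ℝ, 0 < C ∧ 0 < η ∧
      ∀ (𝒳 : Type*) [Fintype 𝒳] [DecidableEq 𝒳]
        (Ω : Type*) [MeasurableSpace Ω] (Ω' : Type*) [MeasurableSpace Ω']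
        (Q : Matrix 𝒳 𝒳 ℝ) (π : 𝒳 → ℝ)
        (P : 𝒳 → Measure Ω) (X : ℝ≥0 → Ω → 𝒳)
        (P' : 𝒳 → Measure Ω') (X' : ℝ≥0 → Ω' → 𝒳)
        (G : Set 𝒳) (α : ℝ) (R : ℝ≥0) (d f r : ℝ),
        IsRateMatrix Q → IsIrreducibleRate Q → IsInvariant Q π →
        IsMarkovChain Q P X → IsMarkovChain (reversedRates Q π) P' X' →
        G.Nonempty → Gᶜ.Nonempty → α ∈ Set.Ioo (0 : ℝ) 1 →
        HpG P X P' X' π G α R d f r →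
        r + 2 * f ^ α < 1 / 4 →
        r + eps2 α d f r ≤ η →
        ∃ (μs : 𝒳 → ℝ) (T ε : ℝ),
          IsQuasiStationary P X π G μs ∧
          (IsIrreducibleOn Q Gᶜ → IsAveragedLimit P X π G μs) ∧
          0 < T ∧ ∫⁻ ω, hit X G ω ∂(fromLaw P μs) = ENNReal.ofReal T ∧
          0 ≤ ε ∧ ε ≤ C * (r + eps2 α d f r) ∧
          (∀ t : ℝ, 0 ≤ t →
            |(fromLaw P (restricted π Gᶜ)).real
                {ω | ENNReal.ofReal t ≤ hit X G ω / ENNReal.ofReal T} - Real.exp (-t)|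
              ≤ ε * Real.exp (-t)) ∧
          (∀ t : ℝ, 0 ≤ t → ∀ x ∈ basin P X P' X' G R f α,
            |(P x).real {ω | ENNReal.ofReal t ≤ hit X G ω / ENNReal.ofReal T} - Real.exp (-t)|
              ≤ ε * Real.exp (-t)) ∧
          (∀ x ∉ basin P X P' X' G R f α,
            (∀ t : ℝ, R / T ≤ t →
              |(P x).real {ω | ENNReal.ofReal t ≤ hit X G ω / ENNReal.ofReal T} -
                  (P x).real {ω | ((2 * R : ℝ≥0) : ℝ≥0∞) < hit X G ω ∧
                    hit X (G ∪ basin P X P' X' G R f α) ω ≤ (R : ℝ≥0∞)} * Real.exp (-t)|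
                ≤ ε * Real.exp (-t)) ∧
            (∀ t : ℝ, 0 ≤ t →
              (P x).real {ω | ((2 * R : ℝ≥0) : ℝ≥0∞) < hit X G ω ∧
                    hit X (G ∪ basin P X P' X' G R f α) ω ≤ (R : ℝ≥0∞)} * Real.exp (-t) -
                  ε * Real.exp (-t)
                ≤ (P x).real {ω | ENNReal.ofReal t ≤ hit X G ω / ENNReal.ofReal T})) := by
  -- The error is `100 * κ` with `κ = 2 * (r + eps2 α d f r)`, hence 200.
  refine ⟨200, 1 / 200, by norm_num, by norm_num, ?_⟩
  intro 𝒳 _ _ Ω _ Ω' _ Q π P X P' X' G α R d f r hQ hirr hinv hX hX' hG hGc _ hH _ hη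
  have hπ := hinv.pos hQ hirr
  have hK := isReturnKernel_killed hX hX' hπ hGc hH hη
  have hBin := restricted_basin_ge hX hX' hπ hGc hH
  have heps := le_eps2 (α := α) (d := d) hH.f_mem.1.le hH.r_mem.1.le
  have hfα : 0 < f ^ α := Real.rpow_pos_of_pos hH.f_mem.1 α
  have hfα' : 0 < f ^ (1 - α) := Real.rpow_pos_of_pos hH.f_mem.1 (1 - α)
  have hd := hH.d_mem.1
  have hr := hH.r_mem.1
  set B := basin P X P' X' G R f α with hB
  set κ := 2 * (r + eps2 α d f r) with hκ
  have hκ0 := hK.κ_nonneg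
  obtain ⟨μ, hμ, hdec, hlim⟩ := hK.exists_quasiStationary
  obtain ⟨b, hb⟩ := hK.nonempty
  have hbG : b ∈ Gᶜ := hb.1
  have hDpos : ∀ t, 0 < decay (killed P X G) μ t := fun t => by
    have h1 := hK.mass_le_decay hμ hdec t b
    have h2 := hK.mass_basin_pos hb t
    nlinarith [hK.decay_nonneg hμ t]
  obtain ⟨t₀, ht₀⟩ := hX.exists_mass_killed_lt_one hirr hG
  have hlt : decay (killed P X G) μ t₀ < 1 := by
    have : Nonempty 𝒳 := ⟨b⟩
    obtain ⟨x₁, hx₁⟩ := Finite.exists_max (mass (killed P X G) t₀)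
    exact (hμ.decay_le t₀ hx₁).trans_lt (ht₀ x₁)
  obtain ⟨l, hl, hexp⟩ := exists_exp_rate hDpos (fun s t hst => hK.decay_anti hμ hst)
    (hK.decay_add hμ) hlt
  have hscale : ∀ t : ℝ, 0 ≤ t →
      decay (killed P X G) μ (t * (1 / l)).toNNReal = Real.exp (-t) := fun t ht => by
    rw [hexp, Real.coe_toNNReal _ (by positivity)]
    congr 1
    field_simp
  have hBlim := fun ν h0 h1 c hc => hlim ν h0 h1 c hc b hb
  refine ⟨μ, 1 / l, 100 * κ, isQuasiStationary_of_tendsto hX hπ hbG hBlim,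
    fun hA => isAveragedLimit_of_tendsto hX hπ hbG hA hBlim, by positivity, ?_, by positivity,
    by rw [hκ]; linarith, ?_, ?_, ?_⟩
  · have : IsFiniteMeasure (fromLaw P μ) := by
      refine ⟨?_⟩
      have := hX.prob
      rw [fromLaw, Measure.finsetSum_apply]
      exact ENNReal.sum_lt_top.mpr fun x _ => by simp
    refine lintegral_eq_of_exp_tail (hX.measurable_hit G) hl fun t => ?_
    rw [← hexp, real_fromLaw hX.prob hμ.nonneg, decay]
    simp only [hX.mass_killed]
  · intro t ht
    rw [real_fromLaw hX.prob (restricted_nonneg hπ hGc)]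
    exact abs_real_le_hit_div_sub_le hX (sum_restricted hπ hGc) hl hexp
      (by positivity) (fun s => hK.abs_average_sub_decay_le hμ hdec s (restricted_nonneg hπ hGc)
        (sum_restricted hπ hGc) (le_trans (by rw [hκ]; linarith) hBin)) ht
  · intro t ht x hx
    have h1 := abs_real_le_hit_div_sub_le hX (G := G) (ν := Pi.single x 1) (by simp) hl hexp
      (ε := 100 * κ) (by positivity) (fun s => by
        simp only [Pi.single_apply, ite_mul, one_mul, zero_mul, Finset.sum_ite_eq',
          Finset.mem_univ, if_true]
        refine (hK.abs_basin_sub_decay_le hμ hdec s hx).trans ?_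
        have := hK.decay_nonneg hμ s
        gcongr
        norm_num) ht
    simpa only [Pi.single_apply, ite_mul, one_mul, zero_mul, Finset.sum_ite_eq',
      Finset.mem_univ, if_true] using h1
  · intro x _
    have := hX.prob x
    set p := (P x).real {ω | ((2 * R : ℝ≥0) : ℝ≥0∞) < hit X G ω ∧
      hit X (G ∪ B) ω ≤ (R : ℝ≥0∞)} with hp
    have hp0 : 0 ≤ p := measureReal_nonneg
    -- The probability in the theorem asks also for survival up to `2 * R`; from the basin this
    -- fails with probability at most κ.
    have hp1 : (P x).real (visits X B G R) * (1 - κ) ≤ p := by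
      rw [hp, hX.visits_inter_survive]
      refine hX.visits_mul_le B G R R x fun b' hb' => ?_
      rw [← two_mul]
      exact hK.slow b' hb'
    have hp2 : p ≤ (P x).real (visits X B G R) := by
      rw [hp, hX.visits_inter_survive]
      exact measureReal_mono Set.inter_subset_left
    have hlate : ∀ t : ℝ, R / (1 / l) ≤ t →
        |(P x).real {ω | ENNReal.ofReal t ≤ hit X G ω / ENNReal.ofReal (1 / l)} -
          p * Real.exp (-t)| ≤ 100 * κ * Real.exp (-t) := by
      intro t ht
      have hR0 : (0 : ℝ) < R := NNReal.coe_pos.mpr hK.R_pos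
      have ht0 : 0 ≤ t := le_trans (by positivity) ht
      have hsR : R ≤ (t * (1 / l)).toNNReal := by
        rw [← NNReal.coe_le_coe, Real.coe_toNNReal _ (by positivity)]
        rwa [div_le_iff₀ (one_div_pos.mpr hl)] at ht
      rw [setOf_le_div_eq (hit X G) ht0 (one_div_pos.mpr hl),
        hX.real_le_hit_eq (lt_of_lt_of_le hK.R_pos hsR), ← hscale t ht0]
      obtain ⟨u, hu⟩ := exists_add_of_le hsR
      rw [hu, add_comm R u]
      exact hK.abs_mass_sub_mul_decay_le hμ hdec u x hp1 hp2
    refine ⟨hlate, fun t ht => ?_⟩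
    rcases le_total ((R : ℝ) / (1 / l)) t with h1 | h1
    · linarith [(abs_le.mp (hlate t h1)).1]
    · rw [setOf_le_div_eq (hit X G) ht (one_div_pos.mpr hl)]
      have hsR : (t * (1 / l)).toNNReal ≤ R := by
        rw [← NNReal.coe_le_coe, Real.coe_toNNReal _ (by positivity)]
        rwa [le_div_iff₀ (one_div_pos.mpr hl)] at h1
      -- Before time `R` the event defining `p` already implies survival, so the lower bound holds
      -- without error.
      have h2 : p ≤ (P x).real {ω | ((t * (1 / l)).toNNReal : ℝ≥0∞) ≤ hit X G ω} := by
        refine measureReal_mono fun ω hω => ?_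
        refine le_trans ?_ (le_of_lt hω.1)
        have : (t * (1 / l)).toNNReal ≤ 2 * R := hsR.trans (by rw [two_mul]; exact le_self_add)
        exact_mod_cast this
      have h3 : p * Real.exp (-t) ≤ p :=
        mul_le_of_le_one_right hp0 (Real.exp_le_one_iff.mpr (by linarith))
      have h4 : 0 ≤ 100 * κ * Real.exp (-t) := by positivity
      linarith
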